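/- Let $\sigma,\epsilon,Fr,\rho_{ref}>0$ and $c\neq0$ be constants, $\Omega\subseteq\mathbb R^2$ open, $(t_0,t_1)$ a time interval, $S=(t_0,t_1)\times\Omega$. Write $\frac{d}{dt}=\partial_t+\hat v\cdot\nabla$; all differentials $d$ of fields and Lie derivatives $\mathcal L_{\hat v}$ are spatial. **The model.** The fields are a velocity $\hat v$, an areal density $D$, a density $\rho>0$, a pressure $p$, a phase $\theta$ and a complex amplitude $a$, all smooth on $S$. The quantities $\rho$ and $D\,d^2r$ are by definition carried by the flow: $\partial_t\rho+\hat v\cdot\nabla\rho=0$ and $\partial_tD+\mathrm{div}(D\hat v)=0$. A solution of the slowly-varying-envelope (SVE) model satisfies Hamilton's principle $\delta\int\!\!\int \ell_{SVE}\,d^2r\,dt=0$ with $$\ell_{SVE}=\tfrac12D\rho|\hat v|^2-p(D-1)+c\,\frac{\sigma^2|a|^2}{\epsilon^2}D\rho\Big(\Big(\frac{d\theta}{dt}\Big)^2-\frac{\rho_{ref}}{\rho}\frac{\epsilon^2}{\sigma^2Fr^2}\Big),$$ for arbitrary smooth variations, compactly supported in $S$, of $p$, $\theta$ and $|a|^2$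 (varied as an independent real field), and for the Euler–Poincaré variations $\delta\hat v=\partial_t\eta+(\hat v\cdot\nabla)\eta-(\eta\cdot\nabla)\hat v$, $\delta D=-\mathrm{div}(D\eta)$, $\delta\rho=-\eta\cdot\nabla\rho$ with $\eta$ a smooth vector field compactly supported in $S$. The positive root $d\theta/dt\ge0$ is chosen. Put $\mathcal N=\sigma^2|a|^2/(4\epsilon^2)$. **Theorem (Kelvin–Noether circulation theorem in the SVE approximation).** For every solution the following hold on $S$. 1. (Origin of the model.) Insert the WKB ansatz $\zeta_\varphi=\Re\big(a\,e^{i(\theta/\epsilon+\varphi)}\big)$ into the Lagrangian density of the unapproximated model, $\big(\tfrac12(|\hat v|^2+\sigma^2(\tfrac{d\zeta}{dt})^2)-\tfrac{\rho_{ref}}{\rho}\tfrac{\zeta^2}{2Fr^2}\big)D\rho-p(D-1)$. Its average over the phase $\varphi\in[0,2\pi]$ equals $\ell_{SVE}$ with $c=\tfrac14$, plus the lower-order terms $\tfrac{\sigma^2}{4}D\rho\big(|\tfrac{da}{dt}|^2+\tfrac2\epsilon\tfrac{d\theta}{dt}\Im(a^*\tfrac{da}{dt})\big)$, which the SVE model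 neglects. 2. $D=1$ and $\mathrm{div}\,\hat v=0$. 3. $\frac{d\theta}{dt}=\frac{\epsilon}{\sigma Fr}\sqrt{\rho_{ref}/\rho}$; in particular $\frac{d\theta}{dt}=\sqrt{\rho_{ref}/\rho}$ in the normalisation $\epsilon=\sigma Fr$. 4. $\rho$ and $|a|^2$ are advected: $\frac{d\rho}{dt}=0=\frac{d|a|^2}{dt}$. 5. $\mathcal N\,d\frac{d\theta}{dt}=\frac{\sigma}{4\epsilon Fr}|a|^2\,d\sqrt{\rho_{ref}/\rho}$, and this wave-momentum 1-form is advected: $(\partial_t+\mathcal L_{\hat v})\big(\mathcal N\,d\frac{d\theta}{dt}\big)=0$. Likewise the 1-forms $|a|^2d\sqrt{\rho_{ref}/\rho}$ and $|a|^2d\rho$ are advected. 6. The 2-form $d|a|^2\wedge d\rho$ is advected, $(\partial_t+\mathcal L_{\hat v})(d|a|^2\wedge d\rho)=0$, and so is its density, the Jacobian: $\frac{d}{dt}J(|a|^2,\rho)=0$. 7. $(\partial_t+\mathcal L_{\hat v})\big(\hat v\cdot dr+\mathcal N\,d\frac{d\theta}{dt}\big)=-\frac1\rho dp+d\big(\tfrac12|\hat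 v|^2\big)$, and the 2D Euler equation $\partial_t\hat v+(\hat v\cdot\nabla)\hat v=-\frac1\rho\nabla p$ holds. 8. For every closed $C^1$ loop $c_t$ in $\Omega$ carried by the flow of $\hat v$ and every $t\in(t_0,t_1)$, $$\frac{d}{dt}\oint_{c_t}\Big(\hat v\cdot dr+\mathcal N\,d\frac{d\theta}{dt}\Big)=-\oint_{c_t}\frac1\rho\,dp.$$ This reduces to the 2D Euler circulation theorem: $\frac{d}{dt}\oint_{c_t}\hat v\cdot dr=-\oint_{c_t}\frac1\rho\,dp$ and $\frac{d}{dt}\oint_{c_t}\mathcal N\,d\frac{d\theta}{dt}=0$. -/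

import Mathlib

open Set MeasureTheory
open scoped ContDiff

noncomputable section

namespace SVE

/-- The horizontal plane, with its Euclidean structure. -/
abbrev Plane : Type := EuclideanSpace ℝ (Fin 2)

/-- Space-time; a point is `z = (t, r)`. A time-dependent field on the plane is a function of `z`. -/
abbrev ST : Type := ℝ × Plane

/-! ### Vector calculus of time-dependent fields -/

/-- The spatial differential `d f` of a (scalar or vector) field at `z`, time being frozen. -/
def dSpace {E : Type*} [NormedAddCommGroup E] [NormedSpace ℝ E] (f : ST → E) (z : ST) :
    Plane →L[ℝ] E :=
  (fderiv ℝ f z).comp (ContinuousLinearMap.inr ℝ ℝ Plane)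

/-- The material derivative `df/dt = ∂ₜ f + (v · ∇) f`, the derivative of `f` in the space-time
direction `(1, v)`. -/
def matDeriv {E : Type*} [NormedAddCommGroup E] [NormedSpace ℝ E] (v : ST → Plane) (f : ST → E)
    (z : ST) : E :=
  fderiv ℝ f z (1, v z)

/-- The spatial divergence of a vector field. -/
def divergence (w : ST → Plane) (z : ST) : ℝ :=
  ∑ i : Fin 2, (dSpace w z (EuclideanSpace.single i 1)) i

/-- `(∂ₜ + ℒ_v) α` for a time-dependent 1-form `α`:
its value on `w` is `((∂ₜ + v · ∇) α)(w) + α((w · ∇) v)`. -/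
def lieOneForm (v : ST → Plane) (α : ST → Plane →L[ℝ] ℝ) (z : ST) : Plane →L[ℝ] ℝ :=
  matDeriv v α z + (α z).comp (dSpace v z)

/-- The wedge product of two covectors, `(α ∧ β)(u, w) = α(u) β(w) - β(u) α(w)`. -/
def wedge (α β : Plane →L[ℝ] ℝ) : Plane →L[ℝ] Plane →L[ℝ] ℝ :=
  α.smulRight β - β.smulRight α

/-- `(∂ₜ + ℒ_v) ω` for a time-dependent 2-form `B`, evaluated on the pair `(u, w)`. -/
def lieTwoForm (v : ST → Plane) (B : ST → Plane →L[ℝ] Plane →L[ℝ] ℝ) (z : ST) (u w : Plane) : ℝ :=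
  matDeriv v B z u w + B z (dSpace v z u) w + B z u (dSpace v z w)

/-- The Jacobian `J(f, g) = ∂ₓ f ∂_y g - ∂_y f ∂ₓ g`. -/
def jacobian (f g : ST → ℝ) (z : ST) : ℝ :=
  dSpace f z (EuclideanSpace.single 0 1) * dSpace g z (EuclideanSpace.single 1 1)
    - dSpace f z (EuclideanSpace.single 1 1) * dSpace g z (EuclideanSpace.single 0 1)

/-- The 1-form `v · dr`. -/
def velocityForm (v : ST → Plane) (z : ST) : Plane →L[ℝ] ℝ := innerSL ℝ (v z)

/-! ### The wave-current action and its slowly-varying-envelope approximation -/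

/-- The parameters: squared aspect ratio `σ²`, WKB parameter `ε`, Froude number `Fr`, constant
reference density `ρref`. -/
structure Params where
  σ : ℝ
  ε : ℝ
  Fr : ℝ
  ρref : ℝ

/-- The Lagrangian density of the wave-current model before approximation, for the elevation `ζ`:
`(½ (|v|² + σ² (dζ/dt)²) - (ρref/ρ) ζ² / (2 Fr²)) D ρ - p (D - 1)`. -/
def fullDensity (P : Params) (v : ST → Plane) (D ρ p ζ : ST → ℝ) (z : ST) : ℝ :=
  ((1 / 2) * (‖v z‖ ^ 2 + P.σ ^ 2 * matDeriv v ζ z ^ 2)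
      - P.ρref / ρ z * (ζ z ^ 2 / (2 * P.Fr ^ 2))) * (D z * ρ z)
    - p z * (D z - 1)

/-- The WKB ansatz `ζ = Re (a exp (i (θ/ε + φ)))`, with a constant shift `φ` of the fast phase. -/
def wkbElevation (P : Params) (a : ST → ℂ) (θ : ST → ℝ) (φ : ℝ) (z : ST) : ℝ :=
  (a z * Complex.exp (Complex.I * ((θ z / P.ε + φ : ℝ) : ℂ))).re

/-- The field variables of the slowly-varying-envelope action: horizontal velocity `v`,
areal density `D`, mass density (buoyancy) `ρ`, pressure `p`, squared amplitude `A = |a|²`,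
phase `θ`. -/
structure State where
  v : ST → Plane
  D : ST → ℝ
  ρ : ST → ℝ
  p : ST → ℝ
  A : ST → ℝ
  θ : ST → ℝ

/-- The Lagrangian density of the slowly-varying-envelope model,
`½ D ρ |v|² - p (D - 1) + c (σ² A / ε²) D ρ ((dθ/dt)² - (ρref/ρ) ε² / (σ² Fr²))`,
where `c` is the numerical normalisation of the wave part. -/
def sveDensity (P : Params) (c : ℝ) (u : State) (z : ST) : ℝ :=
  (1 / 2) * (u.D z * u.ρ z) * ‖u.v z‖ ^ 2 - u.p z * (u.D z - 1)
    + c * (P.σ ^ 2 * u.A z / P.ε ^ 2) * (u.D z * u.ρ z)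
      * (matDeriv u.v u.θ z ^ 2 - P.ρref / u.ρ z * (P.ε ^ 2 / (P.σ ^ 2 * P.Fr ^ 2)))

/-- A smooth variation compactly supported in the space-time domain `S`: a vector field `η`
(the Eulerian displacement of the fluid parcels) and free variations of `p`, `A = |a|²`, `θ`. -/
structure Variation (S : Set ST) where
  η : ST → Plane
  δp : ST → ℝ
  δA : ST → ℝ
  δθ : ST → ℝ
  smooth_η : ContDiff ℝ ∞ η
  smooth_p : ContDiff ℝ ∞ δp
  smooth_A : ContDiff ℝ ∞ δA
  smooth_θ : ContDiff ℝ ∞ δθ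
  compact_η : HasCompactSupport η
  compact_p : HasCompactSupport δp
  compact_A : HasCompactSupport δA
  compact_θ : HasCompactSupport δθ
  support_η : tsupport η ⊆ S
  support_p : tsupport δp ⊆ S
  support_A : tsupport δA ⊆ S
  support_θ : tsupport δθ ⊆ S

/-- The varied fields. The variations of `v`, `D`, `ρ` are the Euler-Poincaré ones, induced by the
displacement `η` of the parcels that carry the scalar `ρ` and the area density `D d²r`:
`δv = ∂ₜ η + (v · ∇) η - (η · ∇) v`, `δD = - div (D η)`, `δρ = - η · ∇ ρ`. -/
def State.vary (u : State) {S : Set ST} (δ : Variation S) (s : ℝ) : State where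
  v z := u.v z + s • (matDeriv u.v δ.η z - dSpace u.v z (δ.η z))
  D z := u.D z - s * divergence (fun y => u.D y • δ.η y) z
  ρ z := u.ρ z - s * dSpace u.ρ z (δ.η z)
  p z := u.p z + s * δ.δp z
  A z := u.A z + s * δ.δA z
  θ z := u.θ z + s * δ.δθ z

/-- Hamilton's principle `δ ∫ ∫ sveDensity d²r dt = 0` on the space-time domain `S`. As the action
itself may be infinite, one subtracts the density of the unvaried fields, which does not depend on
`s`; the integrand is then compactly supported. -/
def HamiltonPrinciple (P : Params) (c : ℝ) (S : Set ST) (u : State) : Prop :=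
  ∀ δ : Variation S,
    HasDerivAt (fun s : ℝ => ∫ z in S, (sveDensity P c (u.vary δ s) z - sveDensity P c u z)) 0 0

/-- The space-time domain over the time interval `(t₀, t₁)` and the planar domain `Ω`. -/
def spaceTime (t₀ t₁ : ℝ) (Ω : Set Plane) : Set ST := Ioo t₀ t₁ ×ˢ Ω

/-- Smooth solutions of the slowly-varying-envelope model on the space-time domain `S`:
`ρ > 0`, the scalar `ρ` and the area density `D d²r` are carried by the flow, and the fields, with
`A = |a|²`, satisfy Hamilton's principle. -/
structure IsSolution (P : Params) (c : ℝ) (S : Set ST) (v : ST → Plane) (D ρ p θ : ST → ℝ)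
    (a : ST → ℂ) : Prop where
  smooth_v : ContDiffOn ℝ ∞ v S
  smooth_D : ContDiffOn ℝ ∞ D S
  smooth_ρ : ContDiffOn ℝ ∞ ρ S
  smooth_p : ContDiffOn ℝ ∞ p S
  smooth_θ : ContDiffOn ℝ ∞ θ S
  smooth_a : ContDiffOn ℝ ∞ a S
  ρ_pos : ∀ z ∈ S, 0 < ρ z
  carried_ρ : ∀ z ∈ S, matDeriv v ρ z = 0
  carried_D : ∀ z ∈ S, matDeriv v D z + D z * divergence v z = 0
  hamilton : HamiltonPrinciple P c S ⟨v, D, ρ, p, fun z => ‖a z‖ ^ 2, θ⟩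

/-- `𝒩 = σ² |a|² / (4 ε²)`. -/
def waveCoeff (P : Params) (a : ST → ℂ) (z : ST) : ℝ := P.σ ^ 2 * ‖a z‖ ^ 2 / (4 * P.ε ^ 2)

/-- The wave-momentum 1-form `𝒩 d(dθ/dt)`. -/
def waveForm (P : Params) (v : ST → Plane) (θ : ST → ℝ) (a : ST → ℂ) (z : ST) : Plane →L[ℝ] ℝ :=
  waveCoeff P a z • dSpace (matDeriv v θ) z

/-! ### Circulation -/

/-- A closed loop `s ↦ γ (t, s)`, `0 ≤ s ≤ 1`, in `Ω`, carried by the flow of `v`. -/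
structure IsMaterialLoop (t₀ t₁ : ℝ) (Ω : Set Plane) (v : ST → Plane) (γ : ℝ × ℝ → Plane) :
    Prop where
  smooth : ContDiffOn ℝ 1 γ (Ioo t₀ t₁ ×ˢ univ)
  closed : ∀ t ∈ Ioo t₀ t₁, γ (t, 0) = γ (t, 1)
  mem : ∀ t ∈ Ioo t₀ t₁, ∀ s ∈ Icc (0 : ℝ) 1, γ (t, s) ∈ Ω
  carried : ∀ t ∈ Ioo t₀ t₁, ∀ s ∈ Icc (0 : ℝ) 1,
    HasDerivAt (fun t' => γ (t', s)) (v (t, γ (t, s))) t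

/-- The loop integral of the 1-form `α` along `γ` at time `t`. -/
def loopIntegral (γ : ℝ × ℝ → Plane) (α : ST → Plane →L[ℝ] ℝ) (t : ℝ) : ℝ :=
  ∫ s in (0 : ℝ)..1, α (t, γ (t, s)) (deriv (fun s' => γ (t, s')) s)

end SVE

end

open SVE

namespace SVE

/-! ### Differentiation rules -/

section Calculus

variable {E F : Type*} [NormedAddCommGroup E] [NormedSpace ℝ E] [NormedAddCommGroup F]
  [NormedSpace ℝ F] {S : Set ST} {z : ST} {v : ST → Plane}

/-! Write T = dθ/dt, A = |a|², κ = ρref ε²/(σ²Fr²), and C = cσ²/ε². Each kind of variation in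
Hamilton's principle gives one equation. Varying p gives D = 1, and transport of D then gives div v
= 0. Varying A gives the dispersion relation ρT² = κ, so T is a function of ρ (positive root), and
the wave part of the Lagrangian vanishes on solutions. Varying θ, after integration by parts along
the divergence-free flow, says that the wave action AρT is advected. Since ρ and T are advected and
ρT > 0, so is A.

The displacement η gives the momentum equation, and here the waves drop out (`momentum_balance`).
Put q = AρT and let W be the velocity variation. Because q is advected, q dθ(η) has material
derivative q (dθ(W) + dT(η)) (`matDeriv_smul_dSpace_apply`). Up to an exact derivative, the wave
terms without div η therefore sum to -CA (2ρT dT + T² dρ)(η) = -CA d(ρT²)(η), which is zero by the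
dispersion relation. The terms with div η carry the factor κ - ρT² = 0. What is left is the Euler
equation with variable density.

The advection statements are formal: ∂ₜ + ℒ_v commutes with the spatial d (`lieOneForm_dSpace`), so
f dg and df ∧ dg are advected whenever f and g are. The wave-momentum form is of the type f dg, with
f a multiple of A and g = √(ρref/ρ). Kelvin's theorem follows from the transport formula
`hasDerivAt_loopIntegral`, since the kinetic-energy term is exact.

Two points need analysis. Hamilton's principle is a derivative of an integral, but the integrand is
a polynomial in s for small s, so its linear coefficient can be read off
(`setIntegral_linear_coeff_eq_zero`). The loops are only C¹, so the time derivative of the tangent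
vector has to be produced from an integral identity (`tangent_sub_tangent`). -/

theorem dSpace_apply (f : ST → E) (z : ST) (w : Plane) : dSpace f z w = fderiv ℝ f z (0, w) := by
  simp [dSpace]

theorem dSpace_mul {f g : ST → ℝ} (hf : DifferentiableAt ℝ f z) (hg : DifferentiableAt ℝ g z) :
    dSpace (fun y => f y * g y) z = f z • dSpace g z + g z • dSpace f z := by
  ext w
  simp [dSpace_apply, fderiv_fun_mul hf hg]

theorem dSpace_smul {f : ST → ℝ} {g : ST → E} (hf : DifferentiableAt ℝ f z)
    (hg : DifferentiableAt ℝ g z) (w : Plane) :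
    dSpace (fun y => f y • g y) z w = f z • dSpace g z w + dSpace f z w • g z := by
  simp [dSpace_apply, fderiv_fun_smul hf hg]

theorem dSpace_inner {f g : ST → Plane} (hf : DifferentiableAt ℝ f z)
    (hg : DifferentiableAt ℝ g z) (w : Plane) :
    dSpace (fun y => inner ℝ (f y) (g y)) z w
      = inner ℝ (f z) (dSpace g z w) + inner ℝ (dSpace f z w) (g z) := by
  simp [dSpace_apply, fderiv_inner_apply ℝ hf hg]

theorem dSpace_half_norm_sq (hv : DifferentiableAt ℝ v z) (w : Plane) :
    dSpace (fun y => (1 / 2) * ‖v y‖ ^ 2) z w = inner ℝ (v z) (dSpace v z w) := by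
  have h : (fun y => (1 / 2) * ‖v y‖ ^ 2) = fun y => (1 / 2 : ℝ) * inner ℝ (v y) (v y) := by
    funext y; rw [real_inner_self_eq_norm_sq]
  rw [h, dSpace_mul (by fun_prop) (hv.inner ℝ hv)]
  simp only [add_apply, smul_apply,
    dSpace_inner hv hv w, real_inner_comm (v z) (dSpace v z w)]
  simp [dSpace]
  ring

theorem matDeriv_add {f g : ST → E} (hf : DifferentiableAt ℝ f z) (hg : DifferentiableAt ℝ g z) :
    matDeriv v (fun y => f y + g y) z = matDeriv v f z + matDeriv v g z := by
  simp [matDeriv, fderiv_fun_add hf hg]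

theorem matDeriv_mul {f g : ST → ℝ} (hf : DifferentiableAt ℝ f z) (hg : DifferentiableAt ℝ g z) :
    matDeriv v (fun y => f y * g y) z = f z * matDeriv v g z + g z * matDeriv v f z := by
  simp [matDeriv, fderiv_fun_mul hf hg]

theorem matDeriv_smul {f : ST → ℝ} {g : ST → E} (hf : DifferentiableAt ℝ f z)
    (hg : DifferentiableAt ℝ g z) :
    matDeriv v (fun y => f y • g y) z = f z • matDeriv v g z + matDeriv v f z • g z := by
  simp [matDeriv, fderiv_fun_smul hf hg]

theorem matDeriv_inner {f g : ST → Plane} (hf : DifferentiableAt ℝ f z)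
    (hg : DifferentiableAt ℝ g z) :
    matDeriv v (fun y => inner ℝ (f y) (g y)) z
      = inner ℝ (f z) (matDeriv v g z) + inner ℝ (matDeriv v f z) (g z) := by
  simp [matDeriv, fderiv_inner_apply ℝ hf hg]

theorem matDeriv_clm_apply {α : ST → E →L[ℝ] F} {f : ST → E} (hα : DifferentiableAt ℝ α z)
    (hf : DifferentiableAt ℝ f z) :
    matDeriv v (fun y => α y (f y)) z = α z (matDeriv v f z) + matDeriv v α z (f z) := by
  simp [matDeriv, fderiv_clm_apply hα hf]

theorem matDeriv_const (e : E) : matDeriv v (fun _ => e) z = 0 := by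
  simp [matDeriv]

theorem matDeriv_congr (hS : IsOpen S) (hz : z ∈ S) {f g : ST → E} (h : EqOn f g S) :
    matDeriv v f z = matDeriv v g z := by
  rw [matDeriv, matDeriv, (h.eventuallyEq_of_mem (hS.mem_nhds hz)).fderiv_eq]

theorem dSpace_congr (hS : IsOpen S) (hz : z ∈ S) {f g : ST → E} (h : EqOn f g S) :
    dSpace f z = dSpace g z := by
  rw [dSpace, dSpace, (h.eventuallyEq_of_mem (hS.mem_nhds hz)).fderiv_eq]

theorem lieOneForm_congr (hS : IsOpen S) (hz : z ∈ S) {α β : ST → Plane →L[ℝ] ℝ}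
    (h : EqOn α β S) : lieOneForm v α z = lieOneForm v β z := by
  rw [lieOneForm, lieOneForm, matDeriv_congr hS hz h, h hz]

theorem divergence_congr (hS : IsOpen S) (hz : z ∈ S) {f g : ST → Plane} (h : EqOn f g S) :
    divergence f z = divergence g z := by
  rw [divergence, divergence, dSpace_congr hS hz h]

/-- The derivative along the flow of a function of an advected scalar vanishes. -/
theorem matDeriv_comp_eq_zero {f : ST → ℝ} {g : ℝ → ℝ} (hg : DifferentiableAt ℝ g (f z))
    (hf : DifferentiableAt ℝ f z) (h : matDeriv v f z = 0) :
    matDeriv v (fun y => g (f y)) z = 0 := by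
  have := (hg.hasFDerivAt.comp z hf.hasFDerivAt).fderiv
  simp only [Function.comp_def] at this
  rw [matDeriv] at h
  simp [matDeriv, this, h]

theorem sum_single_smul (w : Plane) :
    ∑ i : Fin 2, w i • EuclideanSpace.single i (1 : ℝ) = w := by
  ext j
  fin_cases j <;> simp

theorem dSpace_eq_sum (f : ST → ℝ) (z : ST) (w : Plane) :
    dSpace f z w = ∑ i : Fin 2, w i * dSpace f z (EuclideanSpace.single i 1) := by
  conv_lhs => rw [← sum_single_smul w]
  simp only [map_sum, map_smul, smul_eq_mul]

theorem divergence_smul {f : ST → ℝ} {w : ST → Plane} (hf : DifferentiableAt ℝ f z)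
    (hw : DifferentiableAt ℝ w z) :
    divergence (fun y => f y • w y) z = f z * divergence w z + dSpace f z (w z) := by
  simp only [divergence, dSpace_smul hf hw, dSpace_eq_sum f z (w z)]
  simp only [Fin.sum_univ_two, PiLp.add_apply, PiLp.smul_apply, smul_eq_mul]
  ring

theorem matDeriv_eq_add_dSpace (f : ST → E) (z : ST) :
    matDeriv v f z = fderiv ℝ f z (1, 0) + dSpace f z (v z) := by
  rw [matDeriv, dSpace_apply, ← map_add]
  simp

/-! ### Smoothness of derived fields on an open set -/

theorem differentiableAt_of_smooth (hS : IsOpen S) {f : ST → E} (hf : ContDiffOn ℝ ∞ f S)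
    (hz : z ∈ S) : DifferentiableAt ℝ f z :=
  (hf.differentiableOn (by simp)).differentiableAt (hS.mem_nhds hz)

theorem smooth_fderiv (hS : IsOpen S) {f : ST → E} (hf : ContDiffOn ℝ ∞ f S) :
    ContDiffOn ℝ ∞ (fderiv ℝ f) S :=
  hf.fderiv_of_isOpen hS (by simp)

theorem smooth_dSpace (hS : IsOpen S) {f : ST → E} (hf : ContDiffOn ℝ ∞ f S) :
    ContDiffOn ℝ ∞ (dSpace f) S :=
  (smooth_fderiv hS hf).clm_comp contDiffOn_const

theorem smooth_dSpace_apply (hS : IsOpen S) {f : ST → E} {w : ST → Plane}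
    (hf : ContDiffOn ℝ ∞ f S) (hw : ContDiffOn ℝ ∞ w S) :
    ContDiffOn ℝ ∞ (fun z => dSpace f z (w z)) S :=
  (smooth_dSpace hS hf).clm_apply hw

theorem smooth_matDeriv (hS : IsOpen S) {f : ST → E} (hv : ContDiffOn ℝ ∞ v S)
    (hf : ContDiffOn ℝ ∞ f S) : ContDiffOn ℝ ∞ (matDeriv v f) S :=
  (smooth_fderiv hS hf).clm_apply (contDiffOn_const.prodMk hv)

theorem smooth_coord {w : ST → Plane} (hw : ContDiffOn ℝ ∞ w S) (i : Fin 2) :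
    ContDiffOn ℝ ∞ (fun z => w z i) S :=
  (EuclideanSpace.proj (𝕜 := ℝ) i : Plane →L[ℝ] ℝ).contDiff.comp_contDiffOn hw

theorem smooth_divergence (hS : IsOpen S) {w : ST → Plane} (hw : ContDiffOn ℝ ∞ w S) :
    ContDiffOn ℝ ∞ (divergence w) S := by
  unfold divergence
  exact ContDiffOn.sum fun i _ => smooth_coord (smooth_dSpace_apply hS hw contDiffOn_const) i

theorem smooth_lieOneForm (hS : IsOpen S) {α : ST → Plane →L[ℝ] ℝ} (hv : ContDiffOn ℝ ∞ v S)
    (hα : ContDiffOn ℝ ∞ α S) : ContDiffOn ℝ ∞ (lieOneForm v α) S :=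
  (smooth_matDeriv hS hv hα).add (hα.clm_comp (smooth_dSpace hS hv))

/-- The spatial differential commutes with the material derivative up to the Lie-derivative
term. -/
theorem dSpace_matDeriv (hS : IsOpen S) {f : ST → E} (hv : ContDiffOn ℝ ∞ v S)
    (hf : ContDiffOn ℝ ∞ f S) (hz : z ∈ S) (w : Plane) :
    dSpace (matDeriv v f) z w = matDeriv v (dSpace f) z w + dSpace f z (dSpace v z w) := by
  have hdf := differentiableAt_of_smooth hS (smooth_fderiv hS hf) hz
  have hdv := differentiableAt_of_smooth hS hv hz
  -- Symmetry of the second derivative exchanges the directions (1, v) and (0, w). Differentiating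
  -- the factor (1, v) itself produces the stretching term.
  have hsymm : IsSymmSndFDerivAt ℝ f z :=
    (hf.contDiffAt (hS.mem_nhds hz)).isSymmSndFDerivAt (by
      simp only [minSmoothness_of_isRCLikeNormedField]; exact WithTop.coe_le_coe.2 le_top)
  have h1 : HasFDerivAt (fun y => ((1 : ℝ), v y)) ((0 : ST →L[ℝ] ℝ).prod (fderiv ℝ v z)) z :=
    (hasFDerivAt_const _ _).prodMk hdv.hasFDerivAt
  have h2 : fderiv ℝ (matDeriv v f) z
      = (fderiv ℝ f z).comp ((0 : ST →L[ℝ] ℝ).prod (fderiv ℝ v z))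
        + (fderiv ℝ (fderiv ℝ f) z).flip (1, v z) :=
    (hdf.hasFDerivAt.clm_apply h1).fderiv
  have h3 : fderiv ℝ (dSpace f) z (1, v z)
      = (fderiv ℝ (fderiv ℝ f) z (1, v z)).comp (ContinuousLinearMap.inr ℝ ℝ Plane) := by
    have := (hdf.hasFDerivAt.clm_comp
      (hasFDerivAt_const (ContinuousLinearMap.inr ℝ ℝ Plane) z)).fderiv
    change fderiv ℝ (dSpace f) z = _ at this
    rw [this]
    ext
    simp
  rw [dSpace_apply, h2, matDeriv, h3]
  simp [dSpace_apply, hsymm (1, v z) (0, w), add_comm]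

/-- The stretching term in `lieOneForm` is exactly the commutator of `dSpace` with `matDeriv`. -/
theorem lieOneForm_dSpace (hS : IsOpen S) {f : ST → ℝ} (hv : ContDiffOn ℝ ∞ v S)
    (hf : ContDiffOn ℝ ∞ f S) (hz : z ∈ S) :
    lieOneForm v (dSpace f) z = dSpace (matDeriv v f) z := by
  ext w
  simp [lieOneForm, dSpace_matDeriv hS hv hf hz w]

theorem dSpace_eq_zero_of_eqOn (hS : IsOpen S) {f : ST → E} {e : E} (h : ∀ y ∈ S, f y = e)
    (hz : z ∈ S) : dSpace f z = 0 := by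
  rw [dSpace_congr hS hz (g := fun _ => e) h]
  simp [dSpace]

theorem lieOneForm_dSpace_of_advected (hS : IsOpen S) {f : ST → ℝ} (hv : ContDiffOn ℝ ∞ v S)
    (hf : ContDiffOn ℝ ∞ f S) (hadv : ∀ y ∈ S, matDeriv v f y = 0) (hz : z ∈ S) :
    lieOneForm v (dSpace f) z = 0 := by
  rw [lieOneForm_dSpace hS hv hf hz, dSpace_eq_zero_of_eqOn hS hadv hz]

/-- If the scalars `f` and `g` are advected, so is the 1-form `f dg`. -/
theorem lieOneForm_smul_dSpace (hS : IsOpen S) {f g : ST → ℝ} (hv : ContDiffOn ℝ ∞ v S)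
    (hf : ContDiffOn ℝ ∞ f S) (hg : ContDiffOn ℝ ∞ g S) (hf0 : ∀ y ∈ S, matDeriv v f y = 0)
    (hg0 : ∀ y ∈ S, matDeriv v g y = 0) (hz : z ∈ S) :
    lieOneForm v (fun y => f y • dSpace g y) z = 0 := by
  have h := lieOneForm_dSpace_of_advected hS hv hg hg0 hz
  rw [lieOneForm, matDeriv_smul (differentiableAt_of_smooth hS hf hz)
    (differentiableAt_of_smooth hS (smooth_dSpace hS hg) hz), hf0 z hz]
  rw [lieOneForm] at h
  rw [zero_smul, add_zero, ContinuousLinearMap.smul_comp, ← smul_add, h, smul_zero]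

theorem lieOneForm_add (hS : IsOpen S) {α β : ST → Plane →L[ℝ] ℝ} (hα : ContDiffOn ℝ ∞ α S)
    (hβ : ContDiffOn ℝ ∞ β S) (hz : z ∈ S) :
    lieOneForm v (fun y => α y + β y) z = lieOneForm v α z + lieOneForm v β z := by
  rw [lieOneForm, matDeriv_add (differentiableAt_of_smooth hS hα hz)
    (differentiableAt_of_smooth hS hβ hz), lieOneForm, lieOneForm, ContinuousLinearMap.add_comp]
  abel

theorem smooth_velocityForm (hv : ContDiffOn ℝ ∞ v S) : ContDiffOn ℝ ∞ (velocityForm v) S :=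
  (innerSL ℝ (E := Plane)).contDiff.comp_contDiffOn hv

/-- The stretching term of v · dr is w ↦ v · (w · ∇)v, which is d(½|v|²). This is the source of the
kinetic energy in the circulation equation. -/
theorem lieOneForm_velocityForm (hv : DifferentiableAt ℝ v z) :
    lieOneForm v (velocityForm v) z
      = innerSL ℝ (matDeriv v v z) + dSpace (fun y => (1 / 2) * ‖v y‖ ^ 2) z := by
  have h : matDeriv v (velocityForm v) z = innerSL ℝ (matDeriv v v z) := by
    have := ((innerSL ℝ (E := Plane)).hasFDerivAt.comp z hv.hasFDerivAt).fderiv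
    change fderiv ℝ (velocityForm v) z = _ at this
    rw [matDeriv, this]
    simp [matDeriv]
  ext w
  simp only [lieOneForm, h, add_apply, ContinuousLinearMap.comp_apply,
    dSpace_half_norm_sq hv, velocityForm, innerSL_apply_apply]

/-! ### Advection of 2-forms and Jacobians -/

theorem differentiableAt_smulRight {α : ST → E →L[ℝ] ℝ} {β : ST → F}
    (hα : DifferentiableAt ℝ α z) (hβ : DifferentiableAt ℝ β z) :
    DifferentiableAt ℝ (fun y => (α y).smulRight (β y)) z := by
  have h := (isBoundedBilinearMap_smulRight (𝕜 := ℝ) (E := E) (F := F)).differentiableAt (α z, β z)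
  exact h.comp z (hα.prodMk hβ)

theorem differentiableAt_wedge {α β : ST → Plane →L[ℝ] ℝ} (hα : DifferentiableAt ℝ α z)
    (hβ : DifferentiableAt ℝ β z) : DifferentiableAt ℝ (fun y => wedge (α y) (β y)) z :=
  DifferentiableAt.fun_sub (differentiableAt_smulRight hα hβ) (differentiableAt_smulRight hβ hα)

/-- If the scalars `f` and `g` are advected, so is the 2-form `df ∧ dg`. -/
theorem lieTwoForm_wedge_dSpace (hS : IsOpen S) {f g : ST → ℝ} (hv : ContDiffOn ℝ ∞ v S)
    (hf : ContDiffOn ℝ ∞ f S) (hg : ContDiffOn ℝ ∞ g S) (hf0 : ∀ y ∈ S, matDeriv v f y = 0)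
    (hg0 : ∀ y ∈ S, matDeriv v g y = 0) (hz : z ∈ S) (w₁ w₂ : Plane) :
    lieTwoForm v (fun y => wedge (dSpace f y) (dSpace g y)) z w₁ w₂ = 0 := by
  have hdf := differentiableAt_of_smooth hS (smooth_dSpace hS hf) hz
  have hdg := differentiableAt_of_smooth hS (smooth_dSpace hS hg) hz
  -- For an advected scalar the componentwise derivative of dh along the flow is minus the
  -- stretching term, so the Leibniz rule below cancels the two stretching terms of `lieTwoForm`.
  have key : ∀ {h : ST → ℝ}, ContDiffOn ℝ ∞ h S → (∀ y ∈ S, matDeriv v h y = 0) → ∀ w,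
      matDeriv v (dSpace h) z w = -dSpace h z (dSpace v z w) := by
    intro h hh hh0 w
    have := dSpace_matDeriv hS hv hh hz w
    rw [dSpace_eq_zero_of_eqOn hS hh0 hz, zero_apply] at this
    linarith
  have hB : DifferentiableAt ℝ (fun y => wedge (dSpace f y) (dSpace g y)) z :=
    differentiableAt_wedge hdf hdg
  have hval : matDeriv v (fun y => wedge (dSpace f y) (dSpace g y)) z w₁ w₂
      = matDeriv v (fun y => wedge (dSpace f y) (dSpace g y) w₁ w₂) z := by
    rw [matDeriv_clm_apply (hB.clm_apply (differentiableAt_const _)) (differentiableAt_const _),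
      matDeriv_const, matDeriv_clm_apply hB (differentiableAt_const _), matDeriv_const]
    simp
  have happ : ∀ {h : ST → ℝ}, DifferentiableAt ℝ (dSpace h) z → ∀ w,
      matDeriv v (fun y => dSpace h y w) z = matDeriv v (dSpace h) z w := by
    intro h hh w
    rw [matDeriv_clm_apply hh (differentiableAt_const _), matDeriv_const, map_zero, zero_add]
  have dap : ∀ {h : ST → ℝ}, DifferentiableAt ℝ (dSpace h) z → ∀ w,
      DifferentiableAt ℝ (fun y => dSpace h y w) z := fun hh w =>
    hh.clm_apply (differentiableAt_const _)
  have dapn : ∀ {h : ST → ℝ}, DifferentiableAt ℝ (dSpace h) z → ∀ w,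
      DifferentiableAt ℝ (fun y => -dSpace h y w) z := fun hh w => (dap hh w).fun_neg
  rw [lieTwoForm, hval]
  have hexp : (fun y => wedge (dSpace f y) (dSpace g y) w₁ w₂)
      = fun y => dSpace f y w₁ * dSpace g y w₂ + (-dSpace f y w₂) * dSpace g y w₁ := by
    funext y
    simp [wedge]
    ring
  have hneg : matDeriv v (fun y => -dSpace f y w₂) z = -matDeriv v (dSpace f) z w₂ := by
    rw [← happ hdf]
    simp [matDeriv, fderiv_fun_neg]
  rw [hexp, matDeriv_add (DifferentiableAt.fun_mul (dap hdf _) (dap hdg _))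
      (DifferentiableAt.fun_mul (dapn hdf _) (dap hdg _)),
    matDeriv_mul (dap hdf _) (dap hdg _), matDeriv_mul (dapn hdf _) (dap hdg _), hneg,
    happ hdf, happ hdg, happ hdg, key hf hf0, key hg hg0, key hf hf0, key hg hg0]
  simp [wedge]
  ring

/-- In a divergence-free flow the Jacobian of two advected scalars is advected. -/
theorem matDeriv_jacobian_eq_zero (hS : IsOpen S) {f g : ST → ℝ} (hv : ContDiffOn ℝ ∞ v S)
    (hdiv : divergence v z = 0)
    (hf : ContDiffOn ℝ ∞ f S) (hg : ContDiffOn ℝ ∞ g S) (hf0 : ∀ y ∈ S, matDeriv v f y = 0)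
    (hg0 : ∀ y ∈ S, matDeriv v g y = 0) (hz : z ∈ S) :
    matDeriv v (jacobian f g) z = 0 := by
  have hdf := differentiableAt_of_smooth hS (smooth_dSpace hS hf) hz
  have hdg := differentiableAt_of_smooth hS (smooth_dSpace hS hg) hz
  have h := lieTwoForm_wedge_dSpace hS hv hf hg hf0 hg0 hz (EuclideanSpace.single 0 1)
    (EuclideanSpace.single 1 1)
  have hB : DifferentiableAt ℝ (fun y => wedge (dSpace f y) (dSpace g y)) z :=
    differentiableAt_wedge hdf hdg
  have hJ : jacobian f g = fun y => wedge (dSpace f y) (dSpace g y) (EuclideanSpace.single 0 1)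
      (EuclideanSpace.single 1 1) := by
    funext y
    simp [jacobian, wedge]
    ring
  rw [hJ, matDeriv_clm_apply (hB.clm_apply (differentiableAt_const _)) (differentiableAt_const _),
    matDeriv_const, matDeriv_clm_apply hB (differentiableAt_const _), matDeriv_const]
  simp only [map_zero, zero_add]
  rw [lieTwoForm] at h
  simp only [divergence, Fin.sum_univ_two] at hdiv
  simp only [wedge, sub_apply, ContinuousLinearMap.smulRight_apply,
    smul_apply, smul_eq_mul,
    dSpace_eq_sum _ z (dSpace v z _), Fin.sum_univ_two] at h
  unfold wedge
  -- In the plane, B(∂₀v, e₁) + B(e₀, ∂₁v) is the trace of dv times B(e₀, e₁), that is, div v times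
  -- the Jacobian.
  linear_combination h - (dSpace f z (EuclideanSpace.single 0 1) *
    dSpace g z (EuclideanSpace.single 1 1) - dSpace g z (EuclideanSpace.single 0 1) *
    dSpace f z (EuclideanSpace.single 1 1)) * hdiv

end Calculus

/-! ### Integration of compactly supported fields -/

section Integration

variable {S K : Set ST} {v : ST → Plane}

instance : (volume : Measure ST).IsAddHaarMeasure :=
  inferInstanceAs ((volume : Measure ℝ).prod (volume : Measure Plane)).IsAddHaarMeasure

theorem integral_fderiv_eq_zero {F : ST → ℝ} (hF : ContDiff ℝ ∞ F) (hc : HasCompactSupport F)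
    (u : ST) : ∫ z, fderiv ℝ F z u = 0 := by
  have hcont : Continuous fun z => fderiv ℝ F z u :=
    (hF.continuous_fderiv (by simp)).clm_apply continuous_const
  have hc' : HasCompactSupport fun z => fderiv ℝ F z u := hc.fderiv_apply (𝕜 := ℝ) u
  have h := integral_mul_fderiv_eq_neg_fderiv_mul_of_integrable (μ := (volume : Measure ST))
    (f := fun _ : ST => (1 : ℝ)) (g := F) (v := u) (by simp)
    (by simpa using hcont.integrable_of_hasCompactSupport hc')
    (by simpa using hF.continuous.integrable_of_hasCompactSupport hc)
    (fun _ _ => differentiableAt_const _)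
    (fun x _ => (hF.differentiable (by simp)).differentiableAt)
  simpa using h

/-! ### Fields on S that vanish off a compact subset -/

theorem integrableOn_of_zero_off_compact (hS : IsOpen S) (hK : IsCompact K) (hKS : K ⊆ S)
    {f : ST → ℝ} (hf : ContinuousOn f S) (h0 : ∀ z ∈ S, z ∉ K → f z = 0) :
    IntegrableOn f S := by
  refine ((hf.mono hKS).integrableOn_compact hK).of_forall_sdiff_eq_zero hS.measurableSet ?_
  exact fun z hz => h0 z hz.1 hz.2

theorem indicator_eventuallyEq_zero (hK : IsCompact K) {f : ST → ℝ}
    (h0 : ∀ z ∈ S, z ∉ K → f z = 0) {z : ST} (hz : z ∉ K) : S.indicator f =ᶠ[nhds z] 0 := by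
  filter_upwards [hK.isClosed.isOpen_compl.mem_nhds hz] with y hy
  by_cases hyS : y ∈ S
  · simpa [hyS] using h0 y hyS hy
  · simp [hyS]

/-- The fields are smooth only on S. Vanishing off a compact K ⊆ S makes the extension by zero
smooth on all of space-time, where the integral of a derivative vanishes. -/
theorem setIntegral_fderiv_eq_zero (hS : IsOpen S) (hK : IsCompact K) (hKS : K ⊆ S)
    {f : ST → ℝ} (hf : ContDiffOn ℝ ∞ f S) (h0 : ∀ z ∈ S, z ∉ K → f z = 0) (u : ST) :
    ∫ z in S, fderiv ℝ f z u = 0 := by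
  have hsmooth : ContDiff ℝ ∞ (S.indicator f) := by
    refine contDiff_iff_contDiffAt.2 fun z => ?_
    by_cases hz : z ∈ K
    · exact (hf.contDiffAt (hS.mem_nhds (hKS hz))).congr_of_eventuallyEq
        ((eqOn_indicator (f := f)).eventuallyEq_of_mem (hS.mem_nhds (hKS hz)))
    · exact contDiffAt_const.congr_of_eventuallyEq (indicator_eventuallyEq_zero hK h0 hz)
  have hcomp : HasCompactSupport (S.indicator f) :=
    HasCompactSupport.intro hK fun z hz => (indicator_eventuallyEq_zero hK h0 hz).eq_of_nhds
  have heq : EqOn (fun z => fderiv ℝ f z u) (fun z => fderiv ℝ (S.indicator f) z u) S := by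
    intro z hz
    have h : S.indicator f =ᶠ[nhds z] f :=
      (eqOn_indicator (f := f)).eventuallyEq_of_mem (hS.mem_nhds hz)
    simp only [h.fderiv_eq]
  rw [setIntegral_congr_fun hS.measurableSet heq,
    setIntegral_eq_integral_of_forall_compl_eq_zero, integral_fderiv_eq_zero hsmooth hcomp u]
  intro z hz
  rw [(indicator_eventuallyEq_zero hK h0 fun h => hz (hKS h)).fderiv_eq]
  simp

theorem fderiv_zero_off_compact {E : Type*} [NormedAddCommGroup E] [NormedSpace ℝ E]
    (hS : IsOpen S) (hK : IsCompact K) {f : ST → E}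
    (h0 : ∀ z ∈ S, z ∉ K → f z = 0) : ∀ z ∈ S, z ∉ K → fderiv ℝ f z = 0 := by
  intro z hz hzK
  have : f =ᶠ[nhds z] fun _ => 0 := by
    filter_upwards [hK.isClosed.isOpen_compl.mem_nhds hzK, hS.mem_nhds hz] with y hy hyS
    exact h0 y hyS hy
  rw [this.fderiv_eq]
  simp

theorem dSpace_zero_off_compact {E : Type*} [NormedAddCommGroup E] [NormedSpace ℝ E]
    (hS : IsOpen S) (hK : IsCompact K) {f : ST → E}
    (h0 : ∀ z ∈ S, z ∉ K → f z = 0) : ∀ z ∈ S, z ∉ K → dSpace f z = 0 := by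
  intro z hz hzK
  rw [dSpace, fderiv_zero_off_compact hS hK h0 z hz hzK, ContinuousLinearMap.zero_comp]

theorem matDeriv_zero_off_compact {E : Type*} [NormedAddCommGroup E] [NormedSpace ℝ E]
    (hS : IsOpen S) (hK : IsCompact K) {f : ST → E}
    (h0 : ∀ z ∈ S, z ∉ K → f z = 0) : ∀ z ∈ S, z ∉ K → matDeriv v f z = 0 := by
  intro z hz hzK
  rw [matDeriv, fderiv_zero_off_compact hS hK h0 z hz hzK, zero_apply]

theorem divergence_zero_off_compact (hS : IsOpen S) (hK : IsCompact K) {w : ST → Plane}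
    (h0 : ∀ z ∈ S, z ∉ K → w z = 0) : ∀ z ∈ S, z ∉ K → divergence w z = 0 := by
  intro z hz hzK
  simp [divergence, dSpace_zero_off_compact hS hK h0 z hz hzK]

theorem divergence_eq_sum_fderiv {w : ST → Plane} {z : ST} (hw : DifferentiableAt ℝ w z) :
    divergence w z
      = ∑ i : Fin 2, fderiv ℝ (fun y => w y i) z (0, EuclideanSpace.single i 1) := by
  refine Finset.sum_congr rfl fun i _ => ?_
  have h := ((EuclideanSpace.proj (𝕜 := ℝ) i : Plane →L[ℝ] ℝ).hasFDerivAt.comp z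
    hw.hasFDerivAt).fderiv
  change fderiv ℝ (fun y => w y i) z = _ at h
  rw [h, dSpace_apply]
  rfl

theorem setIntegral_divergence_eq_zero (hS : IsOpen S) (hK : IsCompact K) (hKS : K ⊆ S)
    {w : ST → Plane} (hw : ContDiffOn ℝ ∞ w S) (h0 : ∀ z ∈ S, z ∉ K → w z = 0) :
    ∫ z in S, divergence w z = 0 := by
  have h0' : ∀ i : Fin 2, ∀ z ∈ S, z ∉ K → w z i = 0 := fun i z hz hzK => by
    rw [h0 z hz hzK]; rfl
  rw [setIntegral_congr_fun hS.measurableSet fun z hz =>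
    divergence_eq_sum_fderiv (differentiableAt_of_smooth hS hw hz), integral_finsetSum]
  · exact Finset.sum_eq_zero fun i _ =>
      setIntegral_fderiv_eq_zero hS hK hKS (smooth_coord hw i) (h0' i) _
  · intro i _
    refine integrableOn_of_zero_off_compact hS hK hKS
      ((smooth_fderiv hS (smooth_coord hw i)).continuousOn.clm_apply continuousOn_const) ?_
    intro z hz hzK
    rw [fderiv_zero_off_compact hS hK (h0' i) z hz hzK, zero_apply]

/-- Integration by parts along a divergence-free flow. -/
theorem setIntegral_matDeriv_eq_zero (hS : IsOpen S) (hK : IsCompact K) (hKS : K ⊆ S)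
    (hv : ContDiffOn ℝ ∞ v S) (hdiv : ∀ z ∈ S, divergence v z = 0) {f : ST → ℝ}
    (hf : ContDiffOn ℝ ∞ f S) (h0 : ∀ z ∈ S, z ∉ K → f z = 0) :
    ∫ z in S, matDeriv v f z = 0 := by
  have h0' : ∀ z ∈ S, z ∉ K → f z • v z = 0 := fun z hz hzK => by rw [h0 z hz hzK, zero_smul]
  -- With div v = 0 the material derivative is in conservation form, ∂ₜf + div (f v).
  have heq : EqOn (matDeriv v f)
      (fun z => fderiv ℝ f z (1, 0) + divergence (fun y => f y • v y) z) S := by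
    intro z hz
    dsimp only
    rw [matDeriv_eq_add_dSpace, divergence_smul (differentiableAt_of_smooth hS hf hz)
      (differentiableAt_of_smooth hS hv hz), hdiv z hz, mul_zero, zero_add]
  rw [setIntegral_congr_fun hS.measurableSet heq, integral_add,
    setIntegral_fderiv_eq_zero hS hK hKS hf h0,
    setIntegral_divergence_eq_zero hS hK hKS (ContDiffOn.fun_smul hf hv) h0', add_zero]
  · refine integrableOn_of_zero_off_compact hS hK hKS
      ((smooth_fderiv hS hf).continuousOn.clm_apply continuousOn_const) fun z hz hzK => ?_
    rw [fderiv_zero_off_compact hS hK h0 z hz hzK, zero_apply]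
  · exact integrableOn_of_zero_off_compact hS hK hKS
      (smooth_divergence hS (hf.smul hv)).continuousOn (divergence_zero_off_compact hS hK h0')

/-- The fundamental lemma of the calculus of variations on the open set `S`. -/
theorem eq_zero_of_forall_test (hS : IsOpen S) {f : ST → ℝ} (hf : ContinuousOn f S)
    (h : ∀ g : ST → ℝ, ContDiff ℝ ∞ g → HasCompactSupport g → tsupport g ⊆ S →
      ∫ z in S, g z * f z = 0) : ∀ z ∈ S, f z = 0 := by
  have hae : ∀ᵐ z ∂(volume : Measure ST), z ∈ S → f z = 0 := by
    refine hS.ae_eq_zero_of_integral_contDiff_smul_eq_zero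
      (hf.locallyIntegrableOn hS.measurableSet) fun g hg hgc hgS => ?_
    rw [← h g hg hgc hgS, setIntegral_eq_integral_of_forall_compl_eq_zero]
    · rfl
    · intro z hz
      rw [image_eq_zero_of_notMem_tsupport fun hz' => hz (hgS hz'), zero_mul]
  exact Measure.eqOn_open_of_ae_eq ((ae_restrict_iff' hS.measurableSet).2 hae) hS hf
    continuousOn_const

/-- If near `s = 0` the integrand is a polynomial in `s` without constant term, the derivative of
the integral at `0` is the integral of the linear coefficient. -/
theorem setIntegral_linear_coeff_eq_zero {F : ℝ → ST → ℝ} {n : ℕ} {g : ℕ → ST → ℝ}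
    (hS : IsOpen S) (hF : ∀ᶠ s in nhds (0 : ℝ), ∀ z ∈ S,
      F s z = ∑ k ∈ Finset.range (n + 1), s ^ (k + 1) * g k z)
    (hg : ∀ k, IntegrableOn (g k) S)
    (h : HasDerivAt (fun s => ∫ z in S, F s z) 0 0) : ∫ z in S, g 0 z = 0 := by
  have h1 : (fun s => ∫ z in S, F s z) =ᶠ[nhds 0]
      fun s => ∑ k ∈ Finset.range (n + 1), s ^ (k + 1) * ∫ z in S, g k z := by
    filter_upwards [hF] with s hs
    rw [setIntegral_congr_fun hS.measurableSet hs, integral_finsetSum]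
    · simp only [integral_const_mul]
    · exact fun k _ => (hg k).const_mul _
  have h2 : HasDerivAt (fun s : ℝ => ∑ k ∈ Finset.range (n + 1), s ^ (k + 1) * ∫ z in S, g k z)
      (∑ k ∈ Finset.range (n + 1), ((k + 1 : ℕ) * (0 : ℝ) ^ k) * ∫ z in S, g k z) 0 := by
    refine HasDerivAt.fun_sum fun k _ => ?_
    simpa using (hasDerivAt_pow (k + 1) (0 : ℝ)).mul_const (∫ z in S, g k z)
  have h3 := (h.congr_of_eventuallyEq h1.symm).unique h2
  -- The factor 0 ^ k kills every term except k = 0, where 0 ^ 0 = 1.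
  rw [Finset.sum_range_succ'] at h3
  simpa using h3.symm

end Integration

/-! ### The Euler-Lagrange equations of the envelope action -/

section Variations

variable {P : Params} {c : ℝ} {S K : Set ST} {u : State}

/-- The variation of the pressure alone. -/
def pressureVariation (g : ST → ℝ) (hg : ContDiff ℝ ∞ g) (hc : HasCompactSupport g)
    (hgS : tsupport g ⊆ S) : Variation S where
  η := 0
  δp := g
  δA := 0
  δθ := 0
  smooth_η := contDiff_const
  smooth_p := hg
  smooth_A := contDiff_const
  smooth_θ := contDiff_const
  compact_η := HasCompactSupport.zero
  compact_p := hc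
  compact_A := HasCompactSupport.zero
  compact_θ := HasCompactSupport.zero
  support_η := by simp
  support_p := hgS
  support_A := by simp
  support_θ := by simp

/-- The variation of the squared amplitude alone. -/
def amplitudeVariation (g : ST → ℝ) (hg : ContDiff ℝ ∞ g) (hc : HasCompactSupport g)
    (hgS : tsupport g ⊆ S) : Variation S :=
  { pressureVariation (S := S) 0 contDiff_const HasCompactSupport.zero (by simp) with
    δA := g, smooth_A := hg, compact_A := hc, support_A := hgS }

/-- The variation of the phase alone. -/
def phaseVariation (g : ST → ℝ) (hg : ContDiff ℝ ∞ g) (hc : HasCompactSupport g)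
    (hgS : tsupport g ⊆ S) : Variation S :=
  { pressureVariation (S := S) 0 contDiff_const HasCompactSupport.zero (by simp) with
    δθ := g, smooth_θ := hg, compact_θ := hc, support_θ := hgS }

/-- The variation of the flow alone. -/
def flowVariation (η : ST → Plane) (hη : ContDiff ℝ ∞ η) (hc : HasCompactSupport η)
    (hηS : tsupport η ⊆ S) : Variation S :=
  { pressureVariation (S := S) 0 contDiff_const HasCompactSupport.zero (by simp) with
    η := η, smooth_η := hη, compact_η := hc, support_η := hηS }

theorem vary_of_displacement_eq_zero (δ : Variation S) (h : δ.η = 0) (s : ℝ) :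
    u.vary δ s = ⟨u.v, u.D, u.ρ, fun z => u.p z + s * δ.δp z, fun z => u.A z + s * δ.δA z,
      fun z => u.θ z + s * δ.δθ z⟩ := by
  have h1 : ∀ z, matDeriv u.v (0 : ST → Plane) z = 0 := fun z => matDeriv_const 0
  have h2 : ∀ z, divergence (fun _ : ST => (0 : Plane)) z = 0 := fun z => by
    simp [divergence, dSpace]
  simp [State.vary, h, h1, h2]

theorem matDeriv_add_const_mul {f g : ST → ℝ} {v : ST → Plane} {z : ST}
    (hf : DifferentiableAt ℝ f z) (hg : DifferentiableAt ℝ g z) (s : ℝ) :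
    matDeriv v (fun y => f y + s * g y) z = matDeriv v f z + s * matDeriv v g z := by
  rw [matDeriv_add hf (by fun_prop), matDeriv_mul (by fun_prop) hg, matDeriv_const]
  ring

/-- Variation of the pressure: the constraint `D = 1`. -/
theorem areal_density_eq_one (hS : IsOpen S) (hH : HamiltonPrinciple P c S u)
    (hD : ContDiffOn ℝ ∞ u.D S) : ∀ z ∈ S, u.D z = 1 := by
  have h : ∀ z ∈ S, u.D z - 1 = 0 := by
    refine eq_zero_of_forall_test hS (hD.continuousOn.sub continuousOn_const) ?_
    intro g hg hc hgS
    have key := setIntegral_linear_coeff_eq_zero (n := 0) (S := S)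
      (g := fun _ z => -(g z * (u.D z - 1)))
      (F := fun s z => sveDensity P c (u.vary (pressureVariation g hg hc hgS) s) z
        - sveDensity P c u z) hS
      (Filter.Eventually.of_forall fun s z _ => by
        rw [vary_of_displacement_eq_zero _ rfl]
        simp [sveDensity, pressureVariation]
        ring)
      (fun _ => integrableOn_of_zero_off_compact hS hc hgS
        ((hg.continuous.continuousOn.mul (hD.continuousOn.sub continuousOn_const)).neg)
        fun z _ hz => by simp [image_eq_zero_of_notMem_tsupport hz])
      (hH _)
    rw [integral_neg, neg_eq_zero] at key
    exact key
  intro z hz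
  linarith [h z hz]

/-- Variation of the squared amplitude: the dispersion relation. -/
theorem dispersion_relation (hS : IsOpen S) (hH : HamiltonPrinciple P c S u)
    (hσ : P.σ ≠ 0) (hε : P.ε ≠ 0) (hc : c ≠ 0)
    (hv : ContDiffOn ℝ ∞ u.v S) (hρ : ContDiffOn ℝ ∞ u.ρ S) (hθ : ContDiffOn ℝ ∞ u.θ S)
    (hρ0 : ∀ z ∈ S, 0 < u.ρ z) (hD1 : ∀ z ∈ S, u.D z = 1) :
    ∀ z ∈ S, u.ρ z * matDeriv u.v u.θ z ^ 2
      = P.ρref * (P.ε ^ 2 / (P.σ ^ 2 * P.Fr ^ 2)) := by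
  have h : ∀ z ∈ S, c * P.σ ^ 2 / P.ε ^ 2 * (u.ρ z * matDeriv u.v u.θ z ^ 2
      - P.ρref * (P.ε ^ 2 / (P.σ ^ 2 * P.Fr ^ 2))) = 0 := by
    have hcont : ContinuousOn (fun z => c * P.σ ^ 2 / P.ε ^ 2 * (u.ρ z * matDeriv u.v u.θ z ^ 2
      - P.ρref * (P.ε ^ 2 / (P.σ ^ 2 * P.Fr ^ 2)))) S :=
      continuousOn_const.mul ((hρ.continuousOn.mul
        ((smooth_matDeriv hS hv hθ).continuousOn.pow 2)).sub continuousOn_const)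
    refine eq_zero_of_forall_test hS hcont ?_
    intro g hg hgc hgS
    exact setIntegral_linear_coeff_eq_zero (n := 0) (S := S)
      (g := fun _ z => g z * (c * P.σ ^ 2 / P.ε ^ 2 * (u.ρ z * matDeriv u.v u.θ z ^ 2
        - P.ρref * (P.ε ^ 2 / (P.σ ^ 2 * P.Fr ^ 2)))))
      (F := fun s z => sveDensity P c (u.vary (amplitudeVariation g hg hgc hgS) s) z
        - sveDensity P c u z) hS
      (Filter.Eventually.of_forall fun s z hz => by
        -- The division by ρ cancels against the prefactor Dρ, so the density is affine in the
        -- amplitude variation.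
        have hne := (hρ0 z hz).ne'
        rw [vary_of_displacement_eq_zero _ rfl]
        simp only [sveDensity, amplitudeVariation, pressureVariation, hD1 z hz, Pi.zero_apply,
          mul_zero, add_zero, Finset.sum_range_one, zero_add, pow_one]
        field_simp
        ring)
      (fun _ => integrableOn_of_zero_off_compact hS hgc hgS
        (hg.continuous.continuousOn.mul hcont)
        fun z _ hz => by simp [image_eq_zero_of_notMem_tsupport hz])
      (hH _)
  intro z hz
  have h2 : c * P.σ ^ 2 / P.ε ^ 2 ≠ 0 := by positivity
  have := (mul_eq_zero.1 (h z hz)).resolve_left h2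
  linarith

/-- Variation of the phase: conservation of wave action along the flow. -/
theorem waveAction_advected (hS : IsOpen S) (hH : HamiltonPrinciple P c S u)
    (hσ : P.σ ≠ 0) (hε : P.ε ≠ 0) (hc : c ≠ 0)
    (hv : ContDiffOn ℝ ∞ u.v S) (hρ : ContDiffOn ℝ ∞ u.ρ S) (hθ : ContDiffOn ℝ ∞ u.θ S)
    (hA : ContDiffOn ℝ ∞ u.A S)
    (hD1 : ∀ z ∈ S, u.D z = 1) (hdiv : ∀ z ∈ S, divergence u.v z = 0) :
    ∀ z ∈ S, matDeriv u.v (fun y => u.A y * (u.ρ y * matDeriv u.v u.θ y)) z = 0 := by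
  have hT := smooth_matDeriv hS hv hθ
  have hq : ContDiffOn ℝ ∞ (fun y => u.A y * (u.ρ y * matDeriv u.v u.θ y)) S :=
    hA.mul (hρ.mul hT)
  refine eq_zero_of_forall_test hS (smooth_matDeriv hS hv hq).continuousOn ?_
  intro g hg hgc hgS
  have hg0 : ∀ z ∈ S, z ∉ tsupport g → g z = 0 := fun z _ hz =>
    image_eq_zero_of_notMem_tsupport hz
  have hg' := smooth_matDeriv hS hv hg.contDiffOn
  have hg'0 := matDeriv_zero_off_compact (v := u.v) hS hgc hg0
  set C := c * P.σ ^ 2 / P.ε ^ 2 with hC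
  have hC0 : C ≠ 0 := by positivity
  -- The coefficient `g k` belongs to s ^ (k + 1); the square of dθ/dt + s dg/dt gives one linear
  -- and one quadratic term.
  have key := setIntegral_linear_coeff_eq_zero (n := 1) (S := S)
    (g := fun k z => if k = 0 then
        2 * C * (u.A z * (u.ρ z * matDeriv u.v u.θ z) * matDeriv u.v g z)
      else C * (u.A z * u.ρ z * matDeriv u.v g z ^ 2))
    (F := fun s z => sveDensity P c (u.vary (phaseVariation g hg hgc hgS) s) z
      - sveDensity P c u z) hS
    (Filter.Eventually.of_forall fun s z hz => by
      rw [vary_of_displacement_eq_zero _ rfl]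
      simp only [sveDensity, phaseVariation, pressureVariation, hD1 z hz, Pi.zero_apply,
        mul_zero, add_zero, matDeriv_add_const_mul (differentiableAt_of_smooth hS hθ hz)
          (differentiableAt_of_smooth hS hg.contDiffOn hz)]
      simp only [Finset.sum_range_succ, Finset.sum_range_zero, hC, if_true, one_ne_zero, if_false]
      ring)
    (fun k => integrableOn_of_zero_off_compact hS hgc hgS
      (by
        split_ifs
        · exact continuousOn_const.mul (hq.mul hg').continuousOn
        · exact continuousOn_const.mul ((hA.mul hρ).mul (hg'.pow 2)).continuousOn)
      fun z hz hzK => by simp [hg'0 z hz hzK])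
    (hH _)
  simp only [if_true] at key
  rw [integral_const_mul] at key
  replace key := (mul_eq_zero.1 key).resolve_left (by positivity)
  -- Integrating the derivative of (wave action) · g moves the material derivative from the test
  -- function to the wave action.
  have h0 := setIntegral_matDeriv_eq_zero hS hgc hgS hv hdiv (hq.mul hg.contDiffOn)
    (fun z hz hzK => by simp [hg0 z hz hzK])
  have heq : EqOn (matDeriv u.v (fun y => u.A y * (u.ρ y * matDeriv u.v u.θ y) * g y))
      (fun z => u.A z * (u.ρ z * matDeriv u.v u.θ z) * matDeriv u.v g z
        + g z * matDeriv u.v (fun y => u.A y * (u.ρ y * matDeriv u.v u.θ y)) z) S := by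
    intro z hz
    exact matDeriv_mul (differentiableAt_of_smooth hS hq hz)
      (differentiableAt_of_smooth hS hg.contDiffOn hz)
  rw [setIntegral_congr_fun hS.measurableSet heq, integral_add, key, zero_add] at h0
  · exact h0
  · exact integrableOn_of_zero_off_compact hS hgc hgS (hq.mul hg').continuousOn
      fun z hz hzK => by simp [hg'0 z hz hzK]
  · exact integrableOn_of_zero_off_compact hS hgc hgS
      (hg.continuous.continuousOn.mul (smooth_matDeriv hS hv hq).continuousOn)
      fun z hz hzK => by simp [hg0 z hz hzK]

theorem eventually_forall_add_mul_ne_zero (hK : IsCompact K) (hKS : K ⊆ S) {f r : ST → ℝ}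
    (hf : ContinuousOn f S) (hf0 : ∀ z ∈ S, 0 < f z) (hr : ContinuousOn r S)
    (hr0 : ∀ z ∈ S, z ∉ K → r z = 0) :
    ∀ᶠ s in nhds (0 : ℝ), ∀ z ∈ S, f z + s * r z ≠ 0 := by
  -- Write f + s r = f (1 + s r/f). On K the quotient r/f is bounded, so |s| < 1/(|B| + 1) suffices;
  -- off K the perturbation vanishes.
  obtain ⟨B, hB⟩ := hK.exists_bound_of_continuousOn
    ((hr.div hf fun z hz => (hf0 z hz).ne').mono hKS)
  filter_upwards [Metric.ball_mem_nhds (0 : ℝ) (show 0 < 1 / (|B| + 1) by positivity)] with s hs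
  intro z hz
  by_cases hzK : z ∈ K
  · have h1 : |r z / f z| ≤ |B| := (hB z hzK).trans (le_abs_self B)
    rw [mem_ball_zero_iff, Real.norm_eq_abs, lt_div_iff₀ (by positivity)] at hs
    have h2 : |s * (r z / f z)| < 1 := by
      rw [abs_mul]
      nlinarith [abs_nonneg s]
    have h3 : f z + s * r z = f z * (1 + s * (r z / f z)) := by
      field_simp [(hf0 z hz).ne']
    rw [h3]
    exact mul_ne_zero (hf0 z hz).ne' (by linarith [(abs_lt.1 h2).1])
  · rw [hr0 z hz hzK, mul_zero, add_zero]
    exact (hf0 z hz).ne'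

/-- The velocity variation induced by the displacement `η`. -/
noncomputable def velocityVariation (v η : ST → Plane) (z : ST) : Plane :=
  matDeriv v η z - dSpace v z (η z)

/-- The first variation of the envelope action under a displacement of the flow with `D = 1`. -/
theorem firstVariation_displacement (hS : IsOpen S) (hH : HamiltonPrinciple P c S u)
    (hv : ContDiffOn ℝ ∞ u.v S) (hρ : ContDiffOn ℝ ∞ u.ρ S) (hp : ContDiffOn ℝ ∞ u.p S)
    (hθ : ContDiffOn ℝ ∞ u.θ S) (hA : ContDiffOn ℝ ∞ u.A S)
    (hρ0 : ∀ z ∈ S, 0 < u.ρ z) (hD1 : ∀ z ∈ S, u.D z = 1)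
    {η : ST → Plane} (hη : ContDiff ℝ ∞ η) (hηc : HasCompactSupport η) (hηS : tsupport η ⊆ S) :
    ∫ z in S, ((1 / 2) * (u.ρ z * (2 * inner ℝ (u.v z) (velocityVariation u.v η z))
          - (u.ρ z * divergence η z + dSpace u.ρ z (η z)) * ‖u.v z‖ ^ 2)
        + u.p z * divergence η z
        + c * P.σ ^ 2 / P.ε ^ 2 * u.A z * (u.ρ z * (2 * matDeriv u.v u.θ z
            * dSpace u.θ z (velocityVariation u.v η z))
          - (u.ρ z * divergence η z + dSpace u.ρ z (η z)) * matDeriv u.v u.θ z ^ 2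
          + P.ρref * (P.ε ^ 2 / (P.σ ^ 2 * P.Fr ^ 2)) * divergence η z)) = 0 := by
  have hηon : ContDiffOn ℝ ∞ η S := hη.contDiffOn
  have hη0 : ∀ z ∈ S, z ∉ tsupport η → η z = 0 := fun z _ hz =>
    image_eq_zero_of_notMem_tsupport hz
  have hW : ContDiffOn ℝ ∞ (velocityVariation u.v η) S :=
    (smooth_matDeriv hS hv hηon).sub (smooth_dSpace_apply hS hv hηon)
  have hW0 : ∀ z ∈ S, z ∉ tsupport η → velocityVariation u.v η z = 0 := fun z hz hzK => by
    rw [velocityVariation, matDeriv_zero_off_compact hS hηc hη0 z hz hzK, hη0 z hz hzK, map_zero,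
      sub_zero]
  have hd := smooth_divergence hS hηon
  have hd0 := divergence_zero_off_compact hS hηc hη0
  have hr : ContDiffOn ℝ ∞ (fun z => dSpace u.ρ z (η z)) S := smooth_dSpace_apply hS hρ hηon
  have hr0 : ∀ z ∈ S, z ∉ tsupport η → dSpace u.ρ z (η z) = 0 := fun z hz hzK => by
    rw [hη0 z hz hzK, map_zero]
  have hτ : ContDiffOn ℝ ∞ (fun z => dSpace u.θ z (velocityVariation u.v η z)) S :=
    smooth_dSpace_apply hS hθ hW
  have hT := smooth_matDeriv hS hv hθ
  set C := c * P.σ ^ 2 / P.ε ^ 2 with hC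
  set κ := P.ρref * (P.ε ^ 2 / (P.σ ^ 2 * P.Fr ^ 2)) with hκ
  have hDη : ∀ z ∈ S, divergence (fun y => u.D y • η y) z = divergence η z := fun z hz =>
    divergence_congr hS hz fun y hy => by simp [hD1 y hy]
  have hvW : ContDiffOn ℝ ∞ (fun z => inner ℝ (u.v z) (velocityVariation u.v η z)) S :=
    hv.inner ℝ hW
  have hvv : ContDiffOn ℝ ∞ (fun z => ‖u.v z‖ ^ 2) S := hv.norm_sq ℝ
  have hWW : ContDiffOn ℝ ∞ (fun z => ‖velocityVariation u.v η z‖ ^ 2) S := hW.norm_sq ℝ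
  -- Varied D and ρ are affine in s, and |v|² and (dθ/dt)² become quadratic, so the change of the
  -- density is a quartic without constant term. The default branch is the coefficient of s⁴;
  -- indices above 3 never enter the sum.
  refine setIntegral_linear_coeff_eq_zero (n := 3) (S := S)
    (g := fun k z => match k with
      | 0 => (1 / 2) * (u.ρ z * (2 * inner ℝ (u.v z) (velocityVariation u.v η z))
            - (u.ρ z * divergence η z + dSpace u.ρ z (η z)) * ‖u.v z‖ ^ 2)
          + u.p z * divergence η z
          + C * u.A z * (u.ρ z * (2 * matDeriv u.v u.θ z
              * dSpace u.θ z (velocityVariation u.v η z))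
            - (u.ρ z * divergence η z + dSpace u.ρ z (η z)) * matDeriv u.v u.θ z ^ 2
            + κ * divergence η z)
      | 1 => (1 / 2) * (u.ρ z * ‖velocityVariation u.v η z‖ ^ 2
            - (u.ρ z * divergence η z + dSpace u.ρ z (η z))
              * (2 * inner ℝ (u.v z) (velocityVariation u.v η z))
            + divergence η z * dSpace u.ρ z (η z) * ‖u.v z‖ ^ 2)
          + C * u.A z * (u.ρ z * dSpace u.θ z (velocityVariation u.v η z) ^ 2
            - (u.ρ z * divergence η z + dSpace u.ρ z (η z)) * (2 * matDeriv u.v u.θ z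
              * dSpace u.θ z (velocityVariation u.v η z))
            + divergence η z * dSpace u.ρ z (η z) * matDeriv u.v u.θ z ^ 2)
      | 2 => (1 / 2) * (divergence η z * dSpace u.ρ z (η z)
              * (2 * inner ℝ (u.v z) (velocityVariation u.v η z))
            - (u.ρ z * divergence η z + dSpace u.ρ z (η z)) * ‖velocityVariation u.v η z‖ ^ 2)
          + C * u.A z * (divergence η z * dSpace u.ρ z (η z) * (2 * matDeriv u.v u.θ z
              * dSpace u.θ z (velocityVariation u.v η z))
            - (u.ρ z * divergence η z + dSpace u.ρ z (η z))
              * dSpace u.θ z (velocityVariation u.v η z) ^ 2)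
      | _ => (1 / 2) * (divergence η z * dSpace u.ρ z (η z) * ‖velocityVariation u.v η z‖ ^ 2)
          + C * u.A z * (divergence η z * dSpace u.ρ z (η z)
            * dSpace u.θ z (velocityVariation u.v η z) ^ 2))
    (F := fun s z => sveDensity P c (u.vary (flowVariation η hη hηc hηS) s) z
      - sveDensity P c u z) hS ?_ ?_ (hH _)
  -- For small s the varied ρ has no zeros. This matters because ρref/ρ takes the value 0 where ρ =
  -- 0, and the cancellation that makes the density polynomial would fail there.
  · filter_upwards [eventually_forall_add_mul_ne_zero hηc hηS hρ.continuousOn hρ0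
      hr.continuousOn.neg fun z hz hzK => by rw [Pi.neg_apply, hr0 z hz hzK, neg_zero]] with s hs
    intro z hz
    have hne := hs z hz
    have hne0 := (hρ0 z hz).ne'
    have hTs : matDeriv (fun z => u.v z + s • (matDeriv u.v η z - dSpace u.v z (η z))) u.θ z
        = matDeriv u.v u.θ z + s * dSpace u.θ z (velocityVariation u.v η z) := by
      have h : ((1 : ℝ), u.v z + s • velocityVariation u.v η z)
          = (1, u.v z) + s • (0, velocityVariation u.v η z) := by simp
      change fderiv ℝ u.θ z (1, u.v z + s • velocityVariation u.v η z) = _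
      rw [h, map_add, map_smul, smul_eq_mul, dSpace_apply, matDeriv]
    have hnorm : ‖u.v z + s • (matDeriv u.v η z - dSpace u.v z (η z))‖ ^ 2
        = ‖u.v z‖ ^ 2 + 2 * s * inner ℝ (u.v z) (velocityVariation u.v η z)
          + s ^ 2 * ‖velocityVariation u.v η z‖ ^ 2 := by
      rw [norm_add_sq_real, inner_smul_right, norm_smul, mul_pow, Real.norm_eq_abs, sq_abs,
        velocityVariation]
      ring
    simp only [sveDensity, State.vary, flowVariation, pressureVariation, hD1 z hz, Pi.zero_apply,
      mul_zero, add_zero, hDη z hz, hnorm, hTs, Finset.sum_range_succ, Finset.sum_range_zero]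
    have hne' : u.ρ z - s * dSpace u.ρ z (η z) ≠ 0 := by
      intro h; apply hne; rw [Pi.neg_apply]; linarith
    have e1 : ∀ x y w : ℝ, w * ((1 - s * divergence η z) * (u.ρ z - s * dSpace u.ρ z (η z)))
        * (x - P.ρref / (u.ρ z - s * dSpace u.ρ z (η z)) * y)
        = w * ((1 - s * divergence η z) * (u.ρ z - s * dSpace u.ρ z (η z))) * x
          - w * (1 - s * divergence η z) * (P.ρref * y) := by
      intro x y w; field_simp
    have e2 : ∀ x y w : ℝ, w * (1 * u.ρ z) * (x - P.ρref / u.ρ z * y)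
        = w * u.ρ z * x - w * (P.ρref * y) := by
      intro x y w; field_simp
    rw [e1, e2, ← hκ]
    have e3 : c * (P.σ ^ 2 * u.A z / P.ε ^ 2) = C * u.A z := by rw [hC]; ring
    rw [e3]
    ring
  · intro k
    have hsm : ∀ {f : ST → ℝ}, ContDiffOn ℝ ∞ f S → (∀ z ∈ S, z ∉ tsupport η → f z = 0) →
        IntegrableOn f S := fun hf hf0 =>
      integrableOn_of_zero_off_compact hS hηc hηS hf.continuousOn hf0
    rcases k with _ | _ | _ | k
    · exact hsm (by fun_prop) fun z hz hzK => by
        simp [hW0 z hz hzK, hd0 z hz hzK, hη0 z hz hzK]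
    · exact hsm (by fun_prop) fun z hz hzK => by
        simp [hW0 z hz hzK, hd0 z hz hzK, hη0 z hz hzK]
    · exact hsm (by fun_prop) fun z hz hzK => by
        simp [hW0 z hz hzK, hd0 z hz hzK, hη0 z hz hzK]
    · exact hsm (by fun_prop) fun z hz hzK => by
        simp [hW0 z hz hzK, hd0 z hz hzK, hη0 z hz hzK]

/-- If `q` is advected then `q dθ` changes along the flow as `q d(dθ/dt)`, up to stretching. -/
theorem matDeriv_smul_dSpace_apply {v η : ST → Plane} {q θ : ST → ℝ} {z : ST} (hS : IsOpen S)
    (hv : ContDiffOn ℝ ∞ v S) (hθ : ContDiffOn ℝ ∞ θ S) (hq : ContDiffOn ℝ ∞ q S)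
    (hη : ContDiffOn ℝ ∞ η S) (hz : z ∈ S) (hq0 : matDeriv v q z = 0) :
    matDeriv v (fun y => q y * dSpace θ y (η y)) z
      = q z * (dSpace θ z (velocityVariation v η z) + dSpace (matDeriv v θ) z (η z)) := by
  rw [matDeriv_mul (differentiableAt_of_smooth hS hq hz)
    (differentiableAt_of_smooth hS (smooth_dSpace_apply hS hθ hη) hz), hq0,
    matDeriv_clm_apply (differentiableAt_of_smooth hS (smooth_dSpace hS hθ) hz)
    (differentiableAt_of_smooth hS hη hz), dSpace_matDeriv hS hv hθ hz, velocityVariation, map_sub]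
  ring

/-- Bookkeeping for `momentum_balance`: f₁, f₂, f₃ are the exact terms and h is the first variation.
Solving for h avoids a separate proof that it is integrable. -/
theorem setIntegral_eq_zero_of_eqOn (hS : IsOpen S) {b : ℝ} {f₁ f₂ f₃ h g : ST → ℝ}
    (hg : EqOn g (fun z => b * f₁ z + f₂ z + f₃ z - h z) S) (j₁ : IntegrableOn f₁ S)
    (j₂ : IntegrableOn f₂ S) (j₃ : IntegrableOn f₃ S) (jg : IntegrableOn g S)
    (i₁ : ∫ z in S, f₁ z = 0) (i₂ : ∫ z in S, f₂ z = 0) (i₃ : ∫ z in S, f₃ z = 0)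
    (ih : ∫ z in S, h z = 0) : ∫ z in S, g z = 0 := by
  have jb : IntegrableOn (fun z => b * f₁ z) S := j₁.const_mul b
  have j12 : IntegrableOn (fun z => b * f₁ z + f₂ z) S := jb.add j₂
  have j123 : IntegrableOn (fun z => b * f₁ z + f₂ z + f₃ z) S := j12.add j₃
  have hh : EqOn h (fun z => b * f₁ z + f₂ z + f₃ z - g z) S := fun z hz => by
    dsimp only
    rw [hg hz]
    ring
  rw [setIntegral_congr_fun hS.measurableSet hh, integral_sub j123 jg, integral_add j12 j₃,
    integral_add jb j₂, integral_const_mul, i₁, i₂, i₃] at ih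
  linarith

/-- Variation of the flow: the momentum equation. The wave terms cancel. -/
theorem momentum_balance (hS : IsOpen S) (hH : HamiltonPrinciple P c S u)
    (hv : ContDiffOn ℝ ∞ u.v S) (hρ : ContDiffOn ℝ ∞ u.ρ S) (hp : ContDiffOn ℝ ∞ u.p S)
    (hθ : ContDiffOn ℝ ∞ u.θ S) (hA : ContDiffOn ℝ ∞ u.A S)
    (hρ0 : ∀ z ∈ S, 0 < u.ρ z) (hD1 : ∀ z ∈ S, u.D z = 1)
    (hdiv : ∀ z ∈ S, divergence u.v z = 0) (hρadv : ∀ z ∈ S, matDeriv u.v u.ρ z = 0)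
    (hdisp : ∀ z ∈ S, u.ρ z * matDeriv u.v u.θ z ^ 2
      = P.ρref * (P.ε ^ 2 / (P.σ ^ 2 * P.Fr ^ 2)))
    (hwave : ∀ z ∈ S, matDeriv u.v (fun y => u.A y * (u.ρ y * matDeriv u.v u.θ y)) z = 0)
    (e : Plane) : ∀ z ∈ S, u.ρ z * inner ℝ (matDeriv u.v u.v z) e + dSpace u.p z e = 0 := by
  have hT := smooth_matDeriv hS hv hθ
  have hq : ContDiffOn ℝ ∞ (fun y => u.A y * (u.ρ y * matDeriv u.v u.θ y)) S :=
    hA.mul (hρ.mul hT)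
  have hbal : ContDiffOn ℝ ∞
      (fun z => u.ρ z * inner ℝ (matDeriv u.v u.v z) e + dSpace u.p z e) S :=
    (hρ.mul ((smooth_matDeriv hS hv hv).inner ℝ contDiffOn_const)).add
      (smooth_dSpace_apply hS hp contDiffOn_const)
  refine eq_zero_of_forall_test hS hbal.continuousOn ?_
  intro g hg hgc hgS
  -- A displacement in the fixed direction e, localised by the test function g, isolates the
  -- e-component of the momentum equation.
  set η : ST → Plane := fun z => g z • e with hη_def
  have hη : ContDiff ℝ ∞ η := hg.smul contDiff_const
  have hηc : HasCompactSupport η := hgc.smul_right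
  have hηS : tsupport η ⊆ S := (tsupport_smul_subset_left g fun _ => e).trans hgS
  have hηon : ContDiffOn ℝ ∞ η S := hη.contDiffOn
  have hη0 : ∀ z ∈ S, z ∉ tsupport η → η z = 0 := fun z _ hz =>
    image_eq_zero_of_notMem_tsupport hz
  have hfirst := firstVariation_displacement hS hH hv hρ hp hθ hA hρ0 hD1 hη hηc hηS
  set C := c * P.σ ^ 2 / P.ε ^ 2
  set κ := P.ρref * (P.ε ^ 2 / (P.σ ^ 2 * P.Fr ^ 2))
  have hvη : ContDiffOn ℝ ∞ (fun z => inner ℝ (u.v z) (η z)) S := hv.inner ℝ hηon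
  have hdθη : ContDiffOn ℝ ∞ (fun z => dSpace u.θ z (η z)) S := smooth_dSpace_apply hS hθ hηon
  have hvv : ContDiffOn ℝ ∞ (fun z => (1 / 2) * ‖u.v z‖ ^ 2) S :=
    contDiffOn_const.mul (hv.norm_sq ℝ)
  have hw : ContDiffOn ℝ ∞
      (fun z => u.A z * (u.ρ z * matDeriv u.v u.θ z) * dSpace u.θ z (η z)) S := hq.mul hdθη
  have hm : ContDiffOn ℝ ∞ (fun z => u.ρ z * inner ℝ (u.v z) (η z)) S := hρ.mul hvη
  have hb : ContDiffOn ℝ ∞ (fun z => u.p z + (-1) * (u.ρ z * ((1 / 2) * ‖u.v z‖ ^ 2))) S :=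
    hp.add (contDiffOn_const.mul (hρ.mul hvv))
  have hbη : ContDiffOn ℝ ∞
      (fun z => (u.p z + (-1) * (u.ρ z * ((1 / 2) * ‖u.v z‖ ^ 2))) • η z) S := hb.smul hηon
  have hw0 : ∀ z ∈ S, z ∉ tsupport η →
      u.A z * (u.ρ z * matDeriv u.v u.θ z) * dSpace u.θ z (η z) = 0 := fun z hz hzK => by
    simp only [hη0 z hz hzK, map_zero, mul_zero]
  have hm0 : ∀ z ∈ S, z ∉ tsupport η → u.ρ z * inner ℝ (u.v z) (η z) = 0 := fun z hz hzK => by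
    simp only [hη0 z hz hzK, inner_zero_right, mul_zero]
  have hbη0 : ∀ z ∈ S, z ∉ tsupport η →
      (u.p z + (-1) * (u.ρ z * ((1 / 2) * ‖u.v z‖ ^ 2))) • η z = 0 := fun z hz hzK => by
    rw [hη0 z hz hzK, smul_zero]
  -- The balance tested with g equals three exact terms minus the integrand of the first variation:
  -- the first removes the wave momentum, the second the time derivative of η, the third the
  -- divergence of η.
  have hId : EqOn (fun z => g z * (u.ρ z * inner ℝ (matDeriv u.v u.v z) e + dSpace u.p z e))
      (fun z => 2 * C * matDeriv u.v
            (fun y => u.A y * (u.ρ y * matDeriv u.v u.θ y) * dSpace u.θ y (η y)) z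
          + matDeriv u.v (fun y => u.ρ y * inner ℝ (u.v y) (η y)) z
          + divergence (fun y => (u.p y + (-1) * (u.ρ y * ((1 / 2) * ‖u.v y‖ ^ 2))) • η y) z
          - ((1 / 2) * (u.ρ z * (2 * inner ℝ (u.v z) (velocityVariation u.v η z))
              - (u.ρ z * divergence η z + dSpace u.ρ z (η z)) * ‖u.v z‖ ^ 2)
            + u.p z * divergence η z
            + C * u.A z * (u.ρ z * (2 * matDeriv u.v u.θ z
                * dSpace u.θ z (velocityVariation u.v η z))
              - (u.ρ z * divergence η z + dSpace u.ρ z (η z)) * matDeriv u.v u.θ z ^ 2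
              + κ * divergence η z))) S := by
    intro z hz
    have dρ := differentiableAt_of_smooth hS hρ hz
    have dv := differentiableAt_of_smooth hS hv hz
    have dT := differentiableAt_of_smooth hS hT hz
    have dvv := differentiableAt_of_smooth hS hvv hz
    have dη := differentiableAt_of_smooth hS hηon hz
    -- The dispersion relation differentiated along η: d(ρT²)(η) = 0 with T = dθ/dt.
    have hdisp' : u.ρ z * (2 * matDeriv u.v u.θ z * dSpace (matDeriv u.v u.θ) z (η z))
        + matDeriv u.v u.θ z ^ 2 * dSpace u.ρ z (η z) = 0 := by
      have h := dSpace_eq_zero_of_eqOn hS hdisp hz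
      simp only [pow_two] at h
      rw [dSpace_mul dρ (dT.fun_mul dT), dSpace_mul dT dT] at h
      have h' := congrArg (fun L : Plane →L[ℝ] ℝ => L (η z)) h
      simp only [add_apply, smul_apply, smul_eq_mul, zero_apply] at h'
      linear_combination h'
    have hp' : dSpace (fun y => u.p y + (-1) * (u.ρ y * ((1 / 2) * ‖u.v y‖ ^ 2))) z (η z)
        = dSpace u.p z (η z) - u.ρ z * inner ℝ (u.v z) (dSpace u.v z (η z))
          - (1 / 2) * ‖u.v z‖ ^ 2 * dSpace u.ρ z (η z) := by
      have h1 : dSpace (fun y => u.p y + (-1) * (u.ρ y * ((1 / 2) * ‖u.v y‖ ^ 2))) z (η z)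
          = dSpace u.p z (η z)
            + dSpace (fun y => (-1) * (u.ρ y * ((1 / 2) * ‖u.v y‖ ^ 2))) z (η z) := by
        rw [dSpace_apply, fderiv_fun_add (differentiableAt_of_smooth hS hp hz)
          (differentiableAt_of_smooth hS (contDiffOn_const.mul (hρ.mul hvv)) hz)]
        simp only [add_apply, dSpace_apply]
      rw [h1, dSpace_mul (differentiableAt_const _) (dρ.fun_mul dvv), dSpace_mul dρ dvv]
      simp only [add_apply, smul_apply, smul_eq_mul, dSpace_half_norm_sq dv]
      simp [dSpace]
      ring
    have hη1 : g z * (u.ρ z * inner ℝ (matDeriv u.v u.v z) e + dSpace u.p z e)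
        = u.ρ z * inner ℝ (matDeriv u.v u.v z) (η z) + dSpace u.p z (η z) := by
      simp only [hη_def, inner_smul_right, map_smul, smul_eq_mul]
      ring
    dsimp only
    -- Replacing κ by ρT² cancels the wave terms that contain div η. The wave terms that survive add
    -- up to C A d(ρT²)(η).
    rw [hη1, matDeriv_smul_dSpace_apply hS hv hθ hq hηon hz (hwave z hz),
      matDeriv_mul dρ (differentiableAt_of_smooth hS hvη hz), hρadv z hz, matDeriv_inner dv dη,
      divergence_smul (differentiableAt_of_smooth hS hb hz) dη, hp', ← hdisp z hz]
    have hWv : inner ℝ (u.v z) (velocityVariation u.v η z)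
        = inner ℝ (u.v z) (matDeriv u.v η z) - inner ℝ (u.v z) (dSpace u.v z (η z)) := by
      rw [velocityVariation, inner_sub_right]
    rw [hWv]
    linear_combination (-C * u.A z) * hdisp'
  have i1 := setIntegral_matDeriv_eq_zero hS hηc hηS hv hdiv hw hw0
  have i2 := setIntegral_matDeriv_eq_zero hS hηc hηS hv hdiv hm hm0
  have i3 := setIntegral_divergence_eq_zero hS hηc hηS hbη hbη0
  have j1 := integrableOn_of_zero_off_compact hS hηc hηS (smooth_matDeriv hS hv hw).continuousOn
    (matDeriv_zero_off_compact (v := u.v) hS hηc hw0)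
  have j2 := integrableOn_of_zero_off_compact hS hηc hηS (smooth_matDeriv hS hv hm).continuousOn
    (matDeriv_zero_off_compact (v := u.v) hS hηc hm0)
  have j3 := integrableOn_of_zero_off_compact hS hηc hηS (smooth_divergence hS hbη).continuousOn
    (divergence_zero_off_compact hS hηc hbη0)
  have j0 : IntegrableOn
      (fun z => g z * (u.ρ z * inner ℝ (matDeriv u.v u.v z) e + dSpace u.p z e)) S :=
    integrableOn_of_zero_off_compact hS hgc hgS
      (hg.continuous.continuousOn.mul hbal.continuousOn)
      fun z _ hz => by simp only [image_eq_zero_of_notMem_tsupport hz, zero_mul]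
  exact setIntegral_eq_zero_of_eqOn hS hId j1 j2 j3 j0 i1 i2 i3 hfirst

end Variations

/-! ### Circulation along material loops -/

section Circulation

variable {E : Type*} [NormedAddCommGroup E] [NormedSpace ℝ E] {t₀ t₁ t s : ℝ} {Ω : Set Plane}
  {v : ST → Plane} {γ : ℝ × ℝ → Plane}

theorem isOpen_spaceTime (hΩ : IsOpen Ω) : IsOpen (spaceTime t₀ t₁ Ω) := isOpen_Ioo.prod hΩ

namespace IsMaterialLoop

theorem mem_spaceTime (hγ : IsMaterialLoop t₀ t₁ Ω v γ) (ht : t ∈ Ioo t₀ t₁)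
    (hs : s ∈ Icc (0 : ℝ) 1) : (t, γ (t, s)) ∈ spaceTime t₀ t₁ Ω :=
  ⟨ht, hγ.mem t ht s hs⟩

theorem hasFDerivAt (hγ : IsMaterialLoop t₀ t₁ Ω v γ) (ht : t ∈ Ioo t₀ t₁) (s : ℝ) :
    HasFDerivAt γ (fderiv ℝ γ (t, s)) (t, s) :=
  ((hγ.smooth.differentiableOn (by simp)).differentiableAt
    ((isOpen_Ioo.prod isOpen_univ).mem_nhds ⟨ht, mem_univ s⟩)).hasFDerivAt

theorem hasDerivAt_tangent (hγ : IsMaterialLoop t₀ t₁ Ω v γ) (ht : t ∈ Ioo t₀ t₁) (s : ℝ) :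
    HasDerivAt (fun s' => γ (t, s')) (fderiv ℝ γ (t, s) (0, 1)) s :=
  (hγ.hasFDerivAt ht s).comp_hasDerivAt s ((hasDerivAt_const s t).prodMk (hasDerivAt_id s))

theorem hasDerivAt_comp_param (hγ : IsMaterialLoop t₀ t₁ Ω v γ) (hΩ : IsOpen Ω)
    (ht : t ∈ Ioo t₀ t₁) (hs : s ∈ Icc (0 : ℝ) 1) {f : ST → E}
    (hf : ContDiffOn ℝ ∞ f (spaceTime t₀ t₁ Ω)) :
    HasDerivAt (fun s' => f (t, γ (t, s')))
      (dSpace f (t, γ (t, s)) (fderiv ℝ γ (t, s) (0, 1))) s := by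
  have h := (differentiableAt_of_smooth (isOpen_spaceTime hΩ) hf
    (hγ.mem_spaceTime ht hs)).hasFDerivAt.comp_hasDerivAt s
    ((hasDerivAt_const s t).prodMk (hγ.hasDerivAt_tangent ht s))
  rw [dSpace_apply]
  exact h

/-- The space-time velocity of a carried point is (1, v), the direction in which `matDeriv`
differentiates. -/
theorem hasDerivAt_comp_time (hγ : IsMaterialLoop t₀ t₁ Ω v γ) (hΩ : IsOpen Ω)
    (ht : t ∈ Ioo t₀ t₁) (hs : s ∈ Icc (0 : ℝ) 1) {f : ST → E}
    (hf : ContDiffOn ℝ ∞ f (spaceTime t₀ t₁ Ω)) :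
    HasDerivAt (fun t' => f (t', γ (t', s))) (matDeriv v f (t, γ (t, s))) t :=
  (differentiableAt_of_smooth (isOpen_spaceTime hΩ) hf
    (hγ.mem_spaceTime ht hs)).hasFDerivAt.comp_hasDerivAt t
    ((hasDerivAt_id t).prodMk (hγ.carried t ht s hs))

theorem continuousOn_comp (hγ : IsMaterialLoop t₀ t₁ Ω v γ) {X : Type*}
    [TopologicalSpace X] {f : ST → X} (hf : ContinuousOn f (spaceTime t₀ t₁ Ω)) :
    ContinuousOn (fun q : ℝ × ℝ => f (q.1, γ q)) (Ioo t₀ t₁ ×ˢ Icc (0 : ℝ) 1) :=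
  hf.comp (continuousOn_fst.prodMk
    (hγ.smooth.continuousOn.mono (prod_mono_right (subset_univ _))))
    fun _ hq => hγ.mem_spaceTime hq.1 hq.2

theorem continuousOn_tangent (hγ : IsMaterialLoop t₀ t₁ Ω v γ) :
    ContinuousOn (fun q : ℝ × ℝ => fderiv ℝ γ q (0, 1)) (Ioo t₀ t₁ ×ˢ Icc (0 : ℝ) 1) :=
  ((hγ.smooth.continuousOn_fderiv_of_isOpen (isOpen_Ioo.prod isOpen_univ) le_rfl).mono
    (prod_mono_right (subset_univ _))).clm_apply continuousOn_const

theorem continuousOn_apply_tangent (hγ : IsMaterialLoop t₀ t₁ Ω v γ) {α : ST → Plane →L[ℝ] E}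
    (hα : ContinuousOn α (spaceTime t₀ t₁ Ω)) :
    ContinuousOn (fun q : ℝ × ℝ => α (q.1, γ q) (fderiv ℝ γ q (0, 1)))
      (Ioo t₀ t₁ ×ˢ Icc (0 : ℝ) 1) :=
  (hγ.continuousOn_comp hα).clm_apply hγ.continuousOn_tangent

theorem continuousOn_slice_param {X : Type*} [TopologicalSpace X] {G : ℝ × ℝ → X}
    (hG : ContinuousOn G (Ioo t₀ t₁ ×ˢ Icc (0 : ℝ) 1)) (ht : t ∈ Ioo t₀ t₁) :
    ContinuousOn (fun s => G (t, s)) (Icc 0 1) :=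
  hG.comp (by fun_prop) fun _ hs => ⟨ht, hs⟩

theorem continuousOn_slice_time {X : Type*} [TopologicalSpace X] {G : ℝ × ℝ → X}
    (hG : ContinuousOn G (Ioo t₀ t₁ ×ˢ Icc (0 : ℝ) 1)) (hs : s ∈ Icc (0 : ℝ) 1) :
    ContinuousOn (fun t => G (t, s)) (Ioo t₀ t₁) :=
  hG.comp (by fun_prop) fun _ ht => ⟨ht, hs⟩

/-- For a C¹ loop the mixed derivative ∂ₜ∂ₛγ is not given in advance. Instead, integrate ∂ₜγ = v in
time and differentiate the integral in s. The parameter is interior because γ is known to lie in Ω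
and to be carried only for s in [0, 1]. -/
theorem tangent_sub_tangent (hγ : IsMaterialLoop t₀ t₁ Ω v γ) (hΩ : IsOpen Ω)
    (hv : ContDiffOn ℝ ∞ v (spaceTime t₀ t₁ Ω)) {a b : ℝ} (ha : a ∈ Ioo t₀ t₁)
    (hb : b ∈ Ioo t₀ t₁) (hs : s ∈ Ioo (0 : ℝ) 1) :
    fderiv ℝ γ (b, s) (0, 1) - fderiv ℝ γ (a, s) (0, 1)
      = ∫ τ in a..b, dSpace v (τ, γ (τ, s)) (fderiv ℝ γ (τ, s) (0, 1)) := by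
  have hab : uIcc a b ⊆ Ioo t₀ t₁ := OrdConnected.uIcc_subset ordConnected_Ioo ha hb
  have hab' : uIoc a b ⊆ Ioo t₀ t₁ := uIoc_subset_uIcc.trans hab
  have hvc := hγ.continuousOn_comp hv.continuousOn
  have hGc := hγ.continuousOn_apply_tangent (smooth_dSpace (isOpen_spaceTime hΩ) hv).continuousOn
  have hIcc : ∀ {x : ℝ}, x ∈ Ioo (0 : ℝ) 1 → x ∈ Icc (0 : ℝ) 1 := fun h => Ioo_subset_Icc_self h
  obtain ⟨B, hB⟩ := (isCompact_uIcc.prod isCompact_Icc).exists_bound_of_continuousOn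
    (hGc.mono (prod_mono_left hab))
  have h1 := (intervalIntegral.hasDerivAt_integral_of_dominated_loc_of_deriv_le (μ := volume)
    (F := fun x τ => v (τ, γ (τ, x)))
    (F' := fun x τ => dSpace v (τ, γ (τ, x)) (fderiv ℝ γ (τ, x) (0, 1)))
    (bound := fun _ => B) (a := a) (b := b) (Ioo_mem_nhds hs.1 hs.2)
    (by
      filter_upwards [Ioo_mem_nhds hs.1 hs.2] with x hx
      exact ((continuousOn_slice_time hvc (hIcc hx)).mono hab').aestronglyMeasurable
        measurableSet_uIoc)
    ((continuousOn_slice_time hvc (hIcc hs)).mono hab).intervalIntegrable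
    (((continuousOn_slice_time hGc (hIcc hs)).mono hab').aestronglyMeasurable
        measurableSet_uIoc)
    (Filter.Eventually.of_forall fun τ hτ x hx =>
      hB (τ, x) ⟨uIoc_subset_uIcc hτ, hIcc hx⟩)
    intervalIntegrable_const
    (Filter.Eventually.of_forall fun τ hτ x hx =>
      hγ.hasDerivAt_comp_param hΩ (hab' hτ) (hIcc hx) hv)).2
  have h2 : (fun x => ∫ τ in a..b, v (τ, γ (τ, x))) =ᶠ[nhds s] fun x => γ (b, x) - γ (a, x) := by
    filter_upwards [Ioo_mem_nhds hs.1 hs.2] with x hx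
    exact intervalIntegral.integral_eq_sub_of_hasDerivAt
      (f := fun τ => γ (τ, x)) (fun τ hτ => hγ.carried τ (hab hτ) x (hIcc hx))
      ((continuousOn_slice_time hvc (hIcc hx)).mono hab).intervalIntegrable
  exact ((hγ.hasDerivAt_tangent hb s).fun_sub (hγ.hasDerivAt_tangent ha s)).unique
    (h1.congr_of_eventuallyEq h2.symm)

/-- The tangent vector of a material loop is stretched by the velocity gradient. -/
theorem hasDerivAt_tangent_time (hγ : IsMaterialLoop t₀ t₁ Ω v γ) (hΩ : IsOpen Ω)
    (hv : ContDiffOn ℝ ∞ v (spaceTime t₀ t₁ Ω)) (ht : t ∈ Ioo t₀ t₁) (hs : s ∈ Ioo (0 : ℝ) 1) :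
    HasDerivAt (fun t' => fderiv ℝ γ (t', s) (0, 1))
      (dSpace v (t, γ (t, s)) (fderiv ℝ γ (t, s) (0, 1))) t := by
  have hGc := continuousOn_slice_time (hγ.continuousOn_apply_tangent
    (smooth_dSpace (isOpen_spaceTime hΩ) hv).continuousOn) (Ioo_subset_Icc_self hs)
  have h1 : HasDerivAt
      (fun b => ∫ τ in t..b, dSpace v (τ, γ (τ, s)) (fderiv ℝ γ (τ, s) (0, 1)))
      (dSpace v (t, γ (t, s)) (fderiv ℝ γ (t, s) (0, 1))) t :=
    intervalIntegral.integral_hasDerivAt_right (by simp)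
      (hGc.stronglyMeasurableAtFilter isOpen_Ioo t ht)
      (hGc.continuousAt (isOpen_Ioo.mem_nhds ht))
  refine (h1.const_add (fderiv ℝ γ (t, s) (0, 1))).congr_of_eventuallyEq ?_
  filter_upwards [isOpen_Ioo.mem_nhds ht] with b hb
  rw [← hγ.tangent_sub_tangent hΩ hv ht hb hs]
  abel

/-- Since γ is C¹ for all real s, `deriv` is the true partial derivative even at the endpoints 0 and
1. -/
theorem loopIntegral_eq (hγ : IsMaterialLoop t₀ t₁ Ω v γ) (α : ST → Plane →L[ℝ] ℝ)
    (ht : t ∈ Ioo t₀ t₁) :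
    loopIntegral γ α t = ∫ s in (0 : ℝ)..1, α (t, γ (t, s)) (fderiv ℝ γ (t, s) (0, 1)) := by
  simp only [loopIntegral, (hγ.hasDerivAt_tangent ht _).deriv]

theorem intervalIntegrable (hγ : IsMaterialLoop t₀ t₁ Ω v γ) {α : ST → Plane →L[ℝ] ℝ}
    (hα : ContinuousOn α (spaceTime t₀ t₁ Ω)) (ht : t ∈ Ioo t₀ t₁) :
    IntervalIntegrable (fun s => α (t, γ (t, s)) (fderiv ℝ γ (t, s) (0, 1))) volume 0 1 := by
  have h := continuousOn_slice_param (hγ.continuousOn_apply_tangent hα) ht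
  rw [← uIcc_of_le zero_le_one] at h
  exact h.intervalIntegrable

/-- The rate of change of the circulation of a 1-form along a material loop. -/
theorem hasDerivAt_loopIntegral (hγ : IsMaterialLoop t₀ t₁ Ω v γ) (hΩ : IsOpen Ω)
    (hv : ContDiffOn ℝ ∞ v (spaceTime t₀ t₁ Ω)) {α : ST → Plane →L[ℝ] ℝ}
    (hα : ContDiffOn ℝ ∞ α (spaceTime t₀ t₁ Ω)) (ht : t ∈ Ioo t₀ t₁) :
    HasDerivAt (loopIntegral γ α) (loopIntegral γ (lieOneForm v α) t) t := by
  have hS := isOpen_spaceTime (t₀ := t₀) (t₁ := t₁) hΩ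
  have hL := (smooth_lieOneForm hS hv hα).continuousOn
  have hLc := hγ.continuousOn_apply_tangent hL
  -- A compact time interval around t, on which the integrand of the derivative is bounded uniformly
  -- in s.
  obtain ⟨a, b, htab, hab⟩ : ∃ a b, t ∈ Ioo a b ∧ Icc a b ⊆ Ioo t₀ t₁ := by
    refine ⟨(t₀ + t) / 2, (t + t₁) / 2, ⟨?_, ?_⟩, fun x hx => ⟨?_, ?_⟩⟩ <;>
      [skip; skip; have := hx.1; have := hx.2] <;> linarith [ht.1, ht.2]
  obtain ⟨B, hB⟩ := (isCompact_Icc.prod isCompact_Icc).exists_bound_of_continuousOn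
    (hLc.mono (prod_mono_left hab))
  have hΙ : uIoc (0 : ℝ) 1 ⊆ Icc 0 1 := by
    rw [uIoc_of_le zero_le_one]; exact Ioc_subset_Icc_self
  have hmeas : ∀ {β : ST → Plane →L[ℝ] ℝ}, ContinuousOn β (spaceTime t₀ t₁ Ω) →
      ∀ {x : ℝ}, x ∈ Ioo t₀ t₁ → AEStronglyMeasurable
        (fun s => β (x, γ (x, s)) (fderiv ℝ γ (x, s) (0, 1)))
        (volume.restrict (uIoc (0 : ℝ) 1)) := fun hβ x hx =>
    ((continuousOn_slice_param (hγ.continuousOn_apply_tangent hβ) hx).mono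
      hΙ).aestronglyMeasurable measurableSet_uIoc
  -- The stretching law holds for interior s; the half-open interval excludes 0, and 1 is a null
  -- set.
  have hne : ∀ᵐ s : ℝ, s ≠ 1 := compl_mem_ae_iff.2 (measure_singleton 1)
  have h1 := (intervalIntegral.hasDerivAt_integral_of_dominated_loc_of_deriv_le (μ := volume)
    (F := fun x s => α (x, γ (x, s)) (fderiv ℝ γ (x, s) (0, 1)))
    (F' := fun x s => lieOneForm v α (x, γ (x, s)) (fderiv ℝ γ (x, s) (0, 1)))
    (bound := fun _ => B) (a := 0) (b := 1) (Ioo_mem_nhds htab.1 htab.2)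
    (by
      filter_upwards [Ioo_mem_nhds ht.1 ht.2] with x hx
      exact hmeas hα.continuousOn hx)
    (hγ.intervalIntegrable hα.continuousOn ht)
    (hmeas hL ht)
    (Filter.Eventually.of_forall fun s hs x hx =>
      hB (x, s) ⟨Ioo_subset_Icc_self hx, hΙ hs⟩)
    intervalIntegrable_const
    (by
      filter_upwards [hne] with s hs1 hs x hx
      have hx' := hab (Ioo_subset_Icc_self hx)
      have hs' := hΙ hs
      rw [uIoc_of_le zero_le_one] at hs
      have h := (hγ.hasDerivAt_comp_time hΩ hx' hs' hα).clm_apply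
        (hγ.hasDerivAt_tangent_time hΩ hv hx' ⟨hs.1, lt_of_le_of_ne hs.2 hs1⟩)
      exact h)).2
  rw [hγ.loopIntegral_eq _ ht]
  refine h1.congr_of_eventuallyEq ?_
  filter_upwards [isOpen_Ioo.mem_nhds ht] with x hx
  exact hγ.loopIntegral_eq α hx

/-- The circulation of an exact 1-form vanishes. -/
theorem loopIntegral_dSpace (hγ : IsMaterialLoop t₀ t₁ Ω v γ) (hΩ : IsOpen Ω) {f : ST → ℝ}
    (hf : ContDiffOn ℝ ∞ f (spaceTime t₀ t₁ Ω)) (ht : t ∈ Ioo t₀ t₁) :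
    loopIntegral γ (dSpace f) t = 0 := by
  rw [hγ.loopIntegral_eq _ ht, intervalIntegral.integral_eq_sub_of_hasDerivAt
    (f := fun s => f (t, γ (t, s))) (fun s hs => ?_)
    (hγ.intervalIntegrable (smooth_dSpace (isOpen_spaceTime hΩ) hf).continuousOn ht)]
  · simp only [hγ.closed t ht, sub_self]
  · rw [uIcc_of_le zero_le_one] at hs
    exact hγ.hasDerivAt_comp_param hΩ ht hs hf

theorem loopIntegral_congr (hγ : IsMaterialLoop t₀ t₁ Ω v γ) {α β : ST → Plane →L[ℝ] ℝ}
    (h : EqOn α β (spaceTime t₀ t₁ Ω)) (ht : t ∈ Ioo t₀ t₁) :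
    loopIntegral γ α t = loopIntegral γ β t := by
  refine intervalIntegral.integral_congr fun s hs => ?_
  rw [uIcc_of_le zero_le_one] at hs
  simp only [h (hγ.mem_spaceTime ht hs)]

/-- Serves to drop the kinetic-energy term d(½|v|²) from the circulation of the momentum equation.
-/
theorem loopIntegral_neg_add_dSpace (hγ : IsMaterialLoop t₀ t₁ Ω v γ) (hΩ : IsOpen Ω)
    {α : ST → Plane →L[ℝ] ℝ} (hα : ContinuousOn α (spaceTime t₀ t₁ Ω)) {f : ST → ℝ}
    (hf : ContDiffOn ℝ ∞ f (spaceTime t₀ t₁ Ω)) (ht : t ∈ Ioo t₀ t₁) :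
    loopIntegral γ (fun z => -α z + dSpace f z) t = -loopIntegral γ α t := by
  have h0 := hγ.loopIntegral_dSpace hΩ hf ht
  rw [hγ.loopIntegral_eq _ ht] at h0 ⊢
  rw [hγ.loopIntegral_eq _ ht]
  simp only [add_apply, neg_apply]
  have hneg : IntervalIntegrable (fun s => -α (t, γ (t, s)) (fderiv ℝ γ (t, s) (0, 1)))
    volume 0 1 := (hγ.intervalIntegrable hα ht).neg
  rw [intervalIntegral.integral_add hneg (hγ.intervalIntegrable
    (smooth_dSpace (isOpen_spaceTime hΩ) hf).continuousOn ht), h0,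
    intervalIntegral.integral_neg, add_zero]

end IsMaterialLoop

end Circulation

/-! ### The WKB average -/

section WKB

variable {P : Params} {S : Set ST} {v : ST → Plane} {D ρ p θ : ST → ℝ} {a : ST → ℂ} {z : ST}

theorem re_mul_exp_I (w : ℂ) (x : ℝ) :
    (w * Complex.exp (Complex.I * (x : ℂ))).re = w.re * Real.cos x - w.im * Real.sin x := by
  rw [mul_comm Complex.I, Complex.mul_re, Complex.exp_ofReal_mul_I_re,
    Complex.exp_ofReal_mul_I_im]

theorem wkbElevation_eq (P : Params) (a : ST → ℂ) (θ : ST → ℝ) (φ : ℝ) (z : ST) :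
    wkbElevation P a θ φ z
      = (a z).re * Real.cos (θ z / P.ε + φ) - (a z).im * Real.sin (θ z / P.ε + φ) :=
  re_mul_exp_I _ _

/-- The material derivative of the WKB elevation has the amplitude `da/dt + i (dθ/dt) a / ε`. -/
theorem matDeriv_wkbElevation (ha : DifferentiableAt ℝ a z) (hθ : DifferentiableAt ℝ θ z)
    (φ : ℝ) :
    matDeriv v (wkbElevation P a θ φ) z
      = ((matDeriv v a z).re - matDeriv v θ z / P.ε * (a z).im) * Real.cos (θ z / P.ε + φ)
        - ((matDeriv v a z).im + matDeriv v θ z / P.ε * (a z).re)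
          * Real.sin (θ z / P.ε + φ) := by
  have hre : HasFDerivAt (fun y => (a y).re) (Complex.reCLM.comp (fderiv ℝ a z)) z :=
    Complex.reCLM.hasFDerivAt.comp z ha.hasFDerivAt
  have him : HasFDerivAt (fun y => (a y).im) (Complex.imCLM.comp (fderiv ℝ a z)) z :=
    Complex.imCLM.hasFDerivAt.comp z ha.hasFDerivAt
  have hx : HasFDerivAt (fun y => θ y / P.ε + φ) ((P.ε)⁻¹ • fderiv ℝ θ z) z := by
    simp only [div_eq_mul_inv]
    exact (hθ.hasFDerivAt.mul_const _).add_const _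
  have h := (hre.fun_mul hx.cos).fun_sub (him.fun_mul hx.sin)
  have hfun : wkbElevation P a θ φ = fun y => (a y).re * Real.cos (θ y / P.ε + φ)
      - (a y).im * Real.sin (θ y / P.ε + φ) := funext fun y => wkbElevation_eq P a θ φ y
  rw [matDeriv, hfun, h.fderiv]
  simp [matDeriv]
  ring

/-- Over a period cos² and sin² average to ½ and the cross term to 0. The proof uses an explicit
antiderivative whose trigonometric part is periodic. -/
theorem integral_quadratic_phase (x C₀ C₁ A B : ℝ) :
    ∫ φ in (0 : ℝ)..(2 * Real.pi), (C₀ + C₁ * (A * Real.cos (x + φ) - B * Real.sin (x + φ)) ^ 2)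
      = 2 * Real.pi * (C₀ + C₁ * ((A ^ 2 + B ^ 2) / 2)) := by
  have h : ∀ φ ∈ uIcc (0 : ℝ) (2 * Real.pi), HasDerivAt (fun φ =>
      (C₀ + C₁ * ((A ^ 2 + B ^ 2) / 2)) * φ
        + C₁ * ((A ^ 2 - B ^ 2) / 2) * (Real.sin (x + φ) * Real.cos (x + φ))
        + C₁ * (A * B) * Real.cos (x + φ) ^ 2)
      (C₀ + C₁ * (A * Real.cos (x + φ) - B * Real.sin (x + φ)) ^ 2) φ := by
    intro φ _
    have hx : HasDerivAt (fun φ => x + φ) 1 φ := (hasDerivAt_id φ).const_add x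
    have hd := (((hasDerivAt_id φ).const_mul (C₀ + C₁ * ((A ^ 2 + B ^ 2) / 2))).fun_add
      ((hx.sin.fun_mul hx.cos).const_mul (C₁ * ((A ^ 2 - B ^ 2) / 2)))).fun_add
      ((hx.cos.fun_pow 2).const_mul (C₁ * (A * B)))
    refine hd.congr_deriv ?_
    have hsq := Real.sin_sq_add_cos_sq (x + φ)
    push_cast
    linear_combination (-(C₁ * ((A ^ 2 + B ^ 2) / 2))) * hsq
  rw [intervalIntegral.integral_eq_sub_of_hasDerivAt h
    (Continuous.intervalIntegrable (by fun_prop) _ _)]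
  simp only [Real.sin_add_two_pi, Real.cos_add_two_pi, add_zero]
  ring

/-- The phase average of the wave-current Lagrangian on the WKB ansatz. -/
theorem average_fullDensity (hσ : P.σ ≠ 0) (hε : P.ε ≠ 0)
    (ha : DifferentiableAt ℝ a z) (hθ : DifferentiableAt ℝ θ z) :
    (1 / (2 * Real.pi)) *
        ∫ φ in (0 : ℝ)..(2 * Real.pi), fullDensity P v D ρ p (wkbElevation P a θ φ) z
      = sveDensity P (1 / 4) ⟨v, D, ρ, p, fun y => ‖a y‖ ^ 2, θ⟩ z
        + P.σ ^ 2 / 4 * (D z * ρ z) * (‖matDeriv v a z‖ ^ 2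
          + 2 / P.ε * matDeriv v θ z * ((starRingEnd ℂ) (a z) * matDeriv v a z).im) := by
  -- `h1` averages the potential energy, with amplitude a; `h2` the kinetic energy, with amplitude
  -- da/dt + i (dθ/dt) a/ε. The squared modulus of the latter yields both the envelope term and the
  -- neglected ones.
  have h1 := integral_quadratic_phase (θ z / P.ε) 0
    (-(P.ρref / ρ z * (1 / (2 * P.Fr ^ 2)) * (D z * ρ z))) (a z).re (a z).im
  have h2 := integral_quadratic_phase (θ z / P.ε)
    ((1 / 2) * ‖v z‖ ^ 2 * (D z * ρ z) - p z * (D z - 1)) ((1 / 2) * P.σ ^ 2 * (D z * ρ z))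
    ((matDeriv v a z).re - matDeriv v θ z / P.ε * (a z).im)
    ((matDeriv v a z).im + matDeriv v θ z / P.ε * (a z).re)
  have hsplit : ∀ φ, fullDensity P v D ρ p (wkbElevation P a θ φ) z
      = (0 + -(P.ρref / ρ z * (1 / (2 * P.Fr ^ 2)) * (D z * ρ z))
          * ((a z).re * Real.cos (θ z / P.ε + φ) - (a z).im * Real.sin (θ z / P.ε + φ)) ^ 2)
        + ((1 / 2) * ‖v z‖ ^ 2 * (D z * ρ z) - p z * (D z - 1)
          + (1 / 2) * P.σ ^ 2 * (D z * ρ z)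
          * (((matDeriv v a z).re - matDeriv v θ z / P.ε * (a z).im) * Real.cos (θ z / P.ε + φ)
            - ((matDeriv v a z).im + matDeriv v θ z / P.ε * (a z).re)
              * Real.sin (θ z / P.ε + φ)) ^ 2) := by
    intro φ
    rw [fullDensity, matDeriv_wkbElevation ha hθ, wkbElevation_eq]
    ring
  simp only [hsplit]
  rw [intervalIntegral.integral_add (Continuous.intervalIntegrable (by fun_prop) _ _)
    (Continuous.intervalIntegrable (by fun_prop) _ _), h1, h2]
  have hπ := Real.pi_ne_zero
  simp only [sveDensity, ← Complex.normSq_eq_norm_sq, Complex.normSq_apply, Complex.mul_im,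
    Complex.conj_re, Complex.conj_im]
  field_simp
  ring

end WKB

/-! ### Consequences of Hamilton's principle -/

section Solutions

variable {P : Params} {c : ℝ} {S : Set ST} {v : ST → Plane} {D ρ p θ : ST → ℝ} {a : ST → ℂ}

namespace IsSolution

theorem smooth_normSq (h : IsSolution P c S v D ρ p θ a) :
    ContDiffOn ℝ ∞ (fun y => ‖a y‖ ^ 2) S :=
  h.smooth_a.norm_sq ℝ

theorem smooth_sqrt (h : IsSolution P c S v D ρ p θ a) (hρref : 0 < P.ρref) :
    ContDiffOn ℝ ∞ (fun y => Real.sqrt (P.ρref / ρ y)) S :=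
  (contDiffOn_const.fun_div h.smooth_ρ fun z hz => (h.ρ_pos z hz).ne').sqrt fun z hz =>
    (div_pos hρref (h.ρ_pos z hz)).ne'

theorem density_eq_one (h : IsSolution P c S v D ρ p θ a) (hS : IsOpen S) :
    ∀ z ∈ S, D z = 1 :=
  areal_density_eq_one hS h.hamilton h.smooth_D

theorem divergence_eq_zero (h : IsSolution P c S v D ρ p θ a) (hS : IsOpen S) :
    ∀ z ∈ S, divergence v z = 0 := by
  intro z hz
  have h1 := h.carried_D z hz
  rw [matDeriv_congr hS hz (g := fun _ => (1 : ℝ)) (h.density_eq_one hS), matDeriv_const,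
    h.density_eq_one hS z hz, zero_add, one_mul] at h1
  exact h1

theorem dispersion (h : IsSolution P c S v D ρ p θ a) (hS : IsOpen S) (hσ : 0 < P.σ)
    (hε : 0 < P.ε) (hc : c ≠ 0) :
    ∀ z ∈ S, ρ z * matDeriv v θ z ^ 2 = P.ρref * (P.ε ^ 2 / (P.σ ^ 2 * P.Fr ^ 2)) :=
  dispersion_relation hS h.hamilton hσ.ne' hε.ne' hc h.smooth_v h.smooth_ρ h.smooth_θ h.ρ_pos
    (h.density_eq_one hS)

theorem frequency_eq (h : IsSolution P c S v D ρ p θ a) (hS : IsOpen S) (hσ : 0 < P.σ)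
    (hε : 0 < P.ε) (hFr : 0 < P.Fr) (hc : c ≠ 0) (hroot : ∀ z ∈ S, 0 ≤ matDeriv v θ z) :
    ∀ z ∈ S, matDeriv v θ z = P.ε / (P.σ * P.Fr) * Real.sqrt (P.ρref / ρ z) := by
  intro z hz
  have hρ := h.ρ_pos z hz
  have h1 : matDeriv v θ z ^ 2 = (P.ε / (P.σ * P.Fr)) ^ 2 * (P.ρref / ρ z) := by
    have := h.dispersion hS hσ hε hc z hz
    field_simp at this ⊢
    linarith
  rw [← Real.sqrt_sq (hroot z hz), h1, Real.sqrt_mul (by positivity),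
    Real.sqrt_sq (by positivity)]

theorem wave_conserved (h : IsSolution P c S v D ρ p θ a) (hS : IsOpen S) (hσ : 0 < P.σ)
    (hε : 0 < P.ε) (hc : c ≠ 0) :
    ∀ z ∈ S, matDeriv v (fun y => ‖a y‖ ^ 2 * (ρ y * matDeriv v θ y)) z = 0 :=
  waveAction_advected hS h.hamilton hσ.ne' hε.ne' hc h.smooth_v h.smooth_ρ h.smooth_θ
    h.smooth_normSq (h.density_eq_one hS) (h.divergence_eq_zero hS)

theorem sqrt_advected (h : IsSolution P c S v D ρ p θ a) (hS : IsOpen S) (hρref : 0 < P.ρref) :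
    ∀ z ∈ S, matDeriv v (fun y => Real.sqrt (P.ρref / ρ y)) z = 0 := by
  intro z hz
  have hρ := h.ρ_pos z hz
  have hg : DifferentiableAt ℝ (fun x => Real.sqrt (P.ρref / x)) (ρ z) :=
    DifferentiableAt.sqrt (by fun_prop (disch := exact hρ.ne')) (div_pos hρref hρ).ne'
  exact matDeriv_comp_eq_zero (f := ρ) (g := fun x => Real.sqrt (P.ρref / x)) hg
    (differentiableAt_of_smooth hS h.smooth_ρ hz) (h.carried_ρ z hz)

/-- The product A · ρ · dθ/dt is advected. Its factors ρ and dθ/dt, a function of ρ, are advected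
and positive, so A inherits advection. -/
theorem normSq_advected (h : IsSolution P c S v D ρ p θ a) (hS : IsOpen S) (hσ : 0 < P.σ)
    (hε : 0 < P.ε) (hFr : 0 < P.Fr) (hρref : 0 < P.ρref) (hc : c ≠ 0)
    (hroot : ∀ z ∈ S, 0 ≤ matDeriv v θ z) :
    ∀ z ∈ S, matDeriv v (fun y => ‖a y‖ ^ 2) z = 0 := by
  intro z hz
  have hρ := h.ρ_pos z hz
  have hω := h.frequency_eq hS hσ hε hFr hc hroot
  have dA := differentiableAt_of_smooth hS h.smooth_normSq hz
  have dρ := differentiableAt_of_smooth hS h.smooth_ρ hz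
  have hT := smooth_matDeriv hS h.smooth_v h.smooth_θ
  have dT := differentiableAt_of_smooth hS hT hz
  have hT0 : matDeriv v (matDeriv v θ) z = 0 := by
    rw [matDeriv_congr hS hz hω, matDeriv_mul (differentiableAt_const _)
      (differentiableAt_of_smooth hS (h.smooth_sqrt hρref) hz), matDeriv_const,
      h.sqrt_advected hS hρref z hz]
    ring
  have h1 := h.wave_conserved hS hσ hε hc z hz
  rw [matDeriv_mul dA (dρ.fun_mul dT), matDeriv_mul dρ dT, hT0, h.carried_ρ z hz] at h1
  have h2 : ρ z * matDeriv v θ z ≠ 0 := by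
    rw [hω z hz]
    have := Real.sqrt_pos.2 (div_pos hρref hρ)
    positivity
  simpa [h2, hρ.ne'] using h1

theorem waveForm_eq (h : IsSolution P c S v D ρ p θ a) (hS : IsOpen S) (hσ : 0 < P.σ)
    (hε : 0 < P.ε) (hFr : 0 < P.Fr) (hρref : 0 < P.ρref) (hc : c ≠ 0)
    (hroot : ∀ z ∈ S, 0 ≤ matDeriv v θ z) :
    ∀ z ∈ S, waveForm P v θ a z = (P.σ / (4 * P.ε * P.Fr) * ‖a z‖ ^ 2) •
      dSpace (fun y => Real.sqrt (P.ρref / ρ y)) z := by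
  intro z hz
  rw [waveForm, dSpace_congr hS hz (h.frequency_eq hS hσ hε hFr hc hroot),
    dSpace_mul (differentiableAt_const _)
      (differentiableAt_of_smooth hS (h.smooth_sqrt hρref) hz),
    dSpace_eq_zero_of_eqOn hS (fun _ _ => rfl) hz, smul_zero, add_zero, smul_smul, waveCoeff]
  -- The constants combine as σ²/(4ε²) · ε/(σFr) = σ/(4εFr).
  congr 1
  field_simp

theorem smooth_waveForm (h : IsSolution P c S v D ρ p θ a) (hS : IsOpen S) :
    ContDiffOn ℝ ∞ (waveForm P v θ a) S := by
  have h1 : ContDiffOn ℝ ∞ (waveCoeff P a) S :=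
    (contDiffOn_const.mul h.smooth_normSq).div_const _
  exact h1.smul (smooth_dSpace hS (smooth_matDeriv hS h.smooth_v h.smooth_θ))

theorem waveForm_advected (h : IsSolution P c S v D ρ p θ a) (hS : IsOpen S) (hσ : 0 < P.σ)
    (hε : 0 < P.ε) (hFr : 0 < P.Fr) (hρref : 0 < P.ρref) (hc : c ≠ 0)
    (hroot : ∀ z ∈ S, 0 ≤ matDeriv v θ z) :
    ∀ z ∈ S, lieOneForm v (waveForm P v θ a) z = 0 := by
  intro z hz
  rw [lieOneForm_congr hS hz (h.waveForm_eq hS hσ hε hFr hρref hc hroot)]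
  refine lieOneForm_smul_dSpace hS h.smooth_v (contDiffOn_const.mul h.smooth_normSq)
    (h.smooth_sqrt hρref) (fun y hy => ?_) (h.sqrt_advected hS hρref) hz
  rw [matDeriv_mul (differentiableAt_const _) (differentiableAt_of_smooth hS h.smooth_normSq hy),
    h.normSq_advected hS hσ hε hFr hρref hc hroot y hy, matDeriv_const]
  ring

/-- The velocity obeys the 2D Euler equation, written as an identity of 1-forms. -/
theorem euler_form (h : IsSolution P c S v D ρ p θ a) (hS : IsOpen S) (hσ : 0 < P.σ)
    (hε : 0 < P.ε) (hc : c ≠ 0) :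
    ∀ z ∈ S, innerSL ℝ (matDeriv v v z) = -((ρ z)⁻¹ • dSpace p z) := by
  intro z hz
  have hρ := (h.ρ_pos z hz).ne'
  ext w
  have h1 := momentum_balance hS h.hamilton h.smooth_v h.smooth_ρ h.smooth_p h.smooth_θ
    h.smooth_normSq h.ρ_pos (h.density_eq_one hS) (h.divergence_eq_zero hS) h.carried_ρ
    (h.dispersion hS hσ hε hc) (h.wave_conserved hS hσ hε hc) w z hz
  simp only [innerSL_apply_apply, neg_apply, smul_apply, smul_eq_mul]
  simp only at h1
  field_simp
  linarith

theorem lieOneForm_velocityForm (h : IsSolution P c S v D ρ p θ a) (hS : IsOpen S)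
    (hσ : 0 < P.σ) (hε : 0 < P.ε) (hc : c ≠ 0) :
    ∀ z ∈ S, lieOneForm v (velocityForm v) z
      = -((ρ z)⁻¹ • dSpace p z) + dSpace (fun y => (1 / 2) * ‖v y‖ ^ 2) z := fun z hz => by
  rw [SVE.lieOneForm_velocityForm (differentiableAt_of_smooth hS h.smooth_v hz),
    h.euler_form hS hσ hε hc z hz]

/-- Translates the covector dp into the gradient vector at frozen time, to pass from the 1-form
identity to the Euler equation. -/
theorem gradient_slice {z : ST} (hp : DifferentiableAt ℝ p z) :
    innerSL ℝ (gradient (fun r => p (z.1, r)) z.2) = dSpace p z := by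
  have h' : HasFDerivAt (fun r => p (z.1, r)) (dSpace p z) z.2 :=
    HasFDerivAt.comp (g := p) (g' := fderiv ℝ p z) z.2 hp.hasFDerivAt
      (hasFDerivAt_prodMk_right (𝕜 := ℝ) z.1 z.2)
  ext w
  rw [innerSL_apply_apply, h'.hasGradientAt.gradient, InnerProductSpace.toDual_symm_apply]

theorem euler_equation (h : IsSolution P c S v D ρ p θ a) (hS : IsOpen S) (hσ : 0 < P.σ)
    (hε : 0 < P.ε) (hc : c ≠ 0) :
    ∀ z ∈ S, matDeriv v v z = -((ρ z)⁻¹ • gradient (fun r => p (z.1, r)) z.2) := by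
  intro z hz
  have h1 := h.euler_form hS hσ hε hc z hz
  rw [← gradient_slice (differentiableAt_of_smooth hS h.smooth_p hz)] at h1
  refine ext_inner_right ℝ fun w => ?_
  have h2 := congrArg (fun L : Plane →L[ℝ] ℝ => L w) h1
  simpa [inner_smul_left, inner_neg_left] using h2

theorem continuousOn_pressureForm (h : IsSolution P c S v D ρ p θ a) (hS : IsOpen S) :
    ContinuousOn (fun y => (ρ y)⁻¹ • dSpace p y) S :=
  (h.smooth_ρ.continuousOn.inv₀ fun z hz => (h.ρ_pos z hz).ne').smul
    (smooth_dSpace hS h.smooth_p).continuousOn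

end IsSolution

end Solutions

end SVE

theorem mainTheorem5 (P : Params) (hσ : 0 < P.σ) (hε : 0 < P.ε) (hFr : 0 < P.Fr)
    (hρref : 0 < P.ρref) (c : ℝ) (hc : c ≠ 0) (t₀ t₁ : ℝ) (Ω : Set Plane) (hΩ : IsOpen Ω)
    (v : ST → Plane) (D ρ p θ : ST → ℝ) (a : ST → ℂ)
    (hsol : IsSolution P c (spaceTime t₀ t₁ Ω) v D ρ p θ a)
    -- the positive root for `dθ/dt` is chosen
    (hroot : ∀ z ∈ spaceTime t₀ t₁ Ω, 0 ≤ matDeriv v θ z) :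
    -- the WKB ansatz: phase average = envelope density (normalisation 1/4) + lower-order terms
    (∀ z ∈ spaceTime t₀ t₁ Ω,
      (1 / (2 * Real.pi)) *
          ∫ φ in (0 : ℝ)..(2 * Real.pi), fullDensity P v D ρ p (wkbElevation P a θ φ) z
        = sveDensity P (1 / 4) ⟨v, D, ρ, p, fun y => ‖a y‖ ^ 2, θ⟩ z
          + P.σ ^ 2 / 4 * (D z * ρ z) * (‖matDeriv v a z‖ ^ 2
            + 2 / P.ε * matDeriv v θ z * ((starRingEnd ℂ) (a z) * matDeriv v a z).im))
    -- incompressibility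
    ∧ (∀ z ∈ spaceTime t₀ t₁ Ω, D z = 1 ∧ divergence v z = 0)
    -- the phase relation
    ∧ (∀ z ∈ spaceTime t₀ t₁ Ω,
        matDeriv v θ z = P.ε / (P.σ * P.Fr) * Real.sqrt (P.ρref / ρ z))
    ∧ (P.ε = P.σ * P.Fr →
        ∀ z ∈ spaceTime t₀ t₁ Ω, matDeriv v θ z = Real.sqrt (P.ρref / ρ z))
    -- advected scalars
    ∧ (∀ z ∈ spaceTime t₀ t₁ Ω, matDeriv v ρ z = 0 ∧ matDeriv v (fun y => ‖a y‖ ^ 2) z = 0)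
    -- the wave-momentum 1-form: its shape and its advection
    ∧ (∀ z ∈ spaceTime t₀ t₁ Ω,
        waveForm P v θ a z
          = (P.σ / (4 * P.ε * P.Fr) * ‖a z‖ ^ 2) •
              dSpace (fun y => Real.sqrt (P.ρref / ρ y)) z)
    ∧ (∀ z ∈ spaceTime t₀ t₁ Ω,
        lieOneForm v (waveForm P v θ a) z = 0
        ∧ lieOneForm v (fun y => ‖a y‖ ^ 2 • dSpace (fun x => Real.sqrt (P.ρref / ρ x)) y) z = 0
        ∧ lieOneForm v (fun y => ‖a y‖ ^ 2 • dSpace ρ y) z = 0)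
    -- the area form `d|a|² ∧ dρ` and its density
    ∧ (∀ z ∈ spaceTime t₀ t₁ Ω,
        (∀ w₁ w₂ : Plane,
          lieTwoForm v (fun y => wedge (dSpace (fun x => ‖a x‖ ^ 2) y) (dSpace ρ y)) z w₁ w₂ = 0)
        ∧ matDeriv v (jacobian (fun x => ‖a x‖ ^ 2) ρ) z = 0)
    -- the momentum equation, with and without the wave momentum
    ∧ (∀ z ∈ spaceTime t₀ t₁ Ω,
        lieOneForm v (fun y => velocityForm v y + waveForm P v θ a y) z
            = -((ρ z)⁻¹ • dSpace p z) + dSpace (fun y => (1 / 2) * ‖v y‖ ^ 2) z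
        ∧ matDeriv v v z = -((ρ z)⁻¹ • gradient (fun r => p (z.1, r)) z.2))
    -- Kelvin's theorem; its reduction to that of the 2D Euler equations
    ∧ (∀ γ : ℝ × ℝ → Plane, IsMaterialLoop t₀ t₁ Ω v γ → ∀ t ∈ Ioo t₀ t₁,
        HasDerivAt (loopIntegral γ (fun y => velocityForm v y + waveForm P v θ a y))
          (-loopIntegral γ (fun y => (ρ y)⁻¹ • dSpace p y) t) t
        ∧ HasDerivAt (loopIntegral γ (velocityForm v))
          (-loopIntegral γ (fun y => (ρ y)⁻¹ • dSpace p y) t) t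
        ∧ HasDerivAt (loopIntegral γ (waveForm P v θ a)) 0 t) := by
  have hS : IsOpen (spaceTime t₀ t₁ Ω) := isOpen_spaceTime hΩ
  have hA := hsol.normSq_advected hS hσ hε hFr hρref hc hroot
  have hω := hsol.frequency_eq hS hσ hε hFr hc hroot
  have hwave := hsol.waveForm_advected hS hσ hε hFr hρref hc hroot
  have hvel := hsol.lieOneForm_velocityForm hS hσ hε hc
  have hvf := smooth_velocityForm hsol.smooth_v
  have hwf := hsol.smooth_waveForm hS
  -- The wave momentum is advected separately, so adding it leaves the right-hand side of the
  -- velocity equation unchanged.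
  have htotal : ∀ z ∈ spaceTime t₀ t₁ Ω,
      lieOneForm v (fun y => velocityForm v y + waveForm P v θ a y) z
        = -((ρ z)⁻¹ • dSpace p z) + dSpace (fun y => (1 / 2) * ‖v y‖ ^ 2) z := fun z hz => by
    rw [lieOneForm_add hS hvf hwf hz, hwave z hz, hvel z hz, add_zero]
  have hke : ContDiffOn ℝ ∞ (fun y => (1 / 2) * ‖v y‖ ^ 2) (spaceTime t₀ t₁ Ω) :=
    contDiffOn_const.mul (hsol.smooth_v.norm_sq ℝ)
  refine ⟨fun z hz => average_fullDensity hσ.ne' hε.ne'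
      (differentiableAt_of_smooth hS hsol.smooth_a hz)
      (differentiableAt_of_smooth hS hsol.smooth_θ hz),
    fun z hz => ⟨hsol.density_eq_one hS z hz, hsol.divergence_eq_zero hS z hz⟩, hω, ?_,
    fun z hz => ⟨hsol.carried_ρ z hz, hA z hz⟩,
    hsol.waveForm_eq hS hσ hε hFr hρref hc hroot,
    fun z hz => ⟨hwave z hz,
      lieOneForm_smul_dSpace hS hsol.smooth_v hsol.smooth_normSq (hsol.smooth_sqrt hρref) hA
        (hsol.sqrt_advected hS hρref) hz,
      lieOneForm_smul_dSpace hS hsol.smooth_v hsol.smooth_normSq hsol.smooth_ρ hA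
        hsol.carried_ρ hz⟩,
    fun z hz => ⟨lieTwoForm_wedge_dSpace hS hsol.smooth_v hsol.smooth_normSq hsol.smooth_ρ hA
        hsol.carried_ρ hz,
      matDeriv_jacobian_eq_zero hS hsol.smooth_v (hsol.divergence_eq_zero hS z hz)
        hsol.smooth_normSq hsol.smooth_ρ hA hsol.carried_ρ hz⟩,
    fun z hz => ⟨htotal z hz, hsol.euler_equation hS hσ hε hc z hz⟩, ?_⟩
  · intro hεσ z hz
    rw [hω z hz, hεσ, div_self (mul_pos hσ hFr).ne', one_mul]
  · intro γ hγ t ht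
    have hpress := hγ.loopIntegral_neg_add_dSpace hΩ (hsol.continuousOn_pressureForm hS) hke ht
    refine ⟨?_, ?_, ?_⟩
    · rw [← hpress, ← hγ.loopIntegral_congr htotal ht]
      exact hγ.hasDerivAt_loopIntegral hΩ hsol.smooth_v (hvf.add hwf) ht
    · rw [← hpress, ← hγ.loopIntegral_congr hvel ht]
      exact hγ.hasDerivAt_loopIntegral hΩ hsol.smooth_v hvf ht
    · have h := hγ.hasDerivAt_loopIntegral hΩ hsol.smooth_v hwf ht
      rw [hγ.loopIntegral_congr (β := fun _ => 0) hwave ht] at h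
      simpa [loopIntegral] using h
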